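/- Let $N\ge 1$ and let $\Omega\subset\mathbb R^N$ be a nonempty open set with Lebesgue measure. An N-function is a function $G(t)=\int_0^t g(\tau)\,d\tau$ $(t\ge 0)$, where $g:[0,\infty)\to\mathbb R$ is nondecreasing and right-continuous, $g(0)=0$, $g(t)>0$ for $t>0$, and $g(t)\to\infty$ as $t\to\infty$. Its complementary N-function is $G^*(s)=\int_0^s g^*(\sigma)\,d\sigma$, where $g^*(s)=\sup\{t\ge 0: g(t)\le s\}$. Put $\rho(u;G)=\int_\Omega G(|u(x)|)\,dx$ for measurable $u:\Omega\to\mathbb R$, and let $$\|u\|_G=\sup\Big\{\int_\Omega|u(x)v(x)|\,dx:\ v \text{ measurable},\ \rho(v;G^*)\le 1\Big\}.$$ The Orlicz space $L^G(\Omega)$ is the space of (almost everywhere classes of) measurable $u:\Omega\to\mathbb R$ with $\|u\|_G<\infty$, normed by $\|\cdot\|_G$. One says that $G$ satisfies $\Delta_2$ if there are $k>0$ and $T\ge 0$ with $G(2t)\le kG(t)$ for all $t\ge T$, and $\Delta_{2,0}$ if this holds with $T=0$. Let $(G,G^*)$ be a pair of complementary N-functions. Then: 1. if $\Omega$ has finite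 measure, $L^G(\Omega)$ is reflexive if and only if both $G$ and $G^*$ satisfy $\Delta_2$; 2. if $\Omega$ has infinite measure, $L^G(\Omega)$ is reflexive if and only if both $G$ and $G^*$ satisfy $\Delta_{2,0}$. -/

import Mathlib

open MeasureTheory Set Filter Topology

open scoped ENNReal

noncomputable section

/-- An N-function, given by its density `g`: a real function on `[0, ∞)` with `g 0 = 0`,
`g t > 0` for `t > 0`, `g` nondecreasing and right-continuous, and `g t → ∞` as `t → ∞`.
The values of `density` at negative arguments play no role. -/
structure NFunction where
  density : ℝ → ℝ
  density_zero : density 0 = 0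
  density_pos : ∀ t, 0 < t → 0 < density t
  density_mono : MonotoneOn density (Ici 0)
  density_rightCts : ∀ t, 0 ≤ t → ContinuousWithinAt density (Ici t) t
  density_tendsto : Tendsto density atTop atTop

namespace NFunction

/-- The N-function itself, `G(t) = ∫₀ᵗ g(τ) dτ` for `t ≥ 0`. -/
def eval (G : NFunction) (t : ℝ) : ℝ := ∫ τ in (0 : ℝ)..t, G.density τ

/-- The set `{t ≥ 0 : g(t) ≤ s}`. -/
def sublevel (G : NFunction) (s : ℝ) : Set ℝ := {t | 0 ≤ t ∧ G.density t ≤ s}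

/-- The conjugate density `g*(s) = sup {t ≥ 0 : g(t) ≤ s}`. -/
def conjDensity (G : NFunction) (s : ℝ) : ℝ := sSup (G.sublevel s)

theorem density_nonneg (G : NFunction) {t : ℝ} (ht : 0 ≤ t) : 0 ≤ G.density t := by
  rcases ht.eq_or_lt with h | h
  · rw [← h, G.density_zero]
  · exact (G.density_pos t h).le

theorem le_of_lt_density (G : NFunction) {s M t : ℝ} (hM : 0 ≤ M) (h : s < G.density M)
    (ht : t ∈ G.sublevel s) : t ≤ M := by
  by_contra! hlt
  exact absurd (G.density_mono hM ht.1 hlt.le) (not_le.2 (ht.2.trans_lt h))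

theorem bddAbove_sublevel (G : NFunction) (s : ℝ) : BddAbove (G.sublevel s) := by
  obtain ⟨M, hM, hs⟩ :=
    ((eventually_ge_atTop (0 : ℝ)).and (G.density_tendsto.eventually_gt_atTop s)).exists
  exact ⟨M, fun t ht => G.le_of_lt_density hM hs ht⟩

theorem zero_mem_sublevel (G : NFunction) {s : ℝ} (hs : 0 ≤ s) : 0 ∈ G.sublevel s :=
  ⟨le_rfl, by rw [G.density_zero]; exact hs⟩

theorem le_conjDensity (G : NFunction) {s t : ℝ} (ht : 0 ≤ t) (h : G.density t ≤ s) :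
    t ≤ G.conjDensity s :=
  le_csSup (G.bddAbove_sublevel s) ⟨ht, h⟩

theorem conjDensity_le (G : NFunction) {s M : ℝ} (hs : 0 ≤ s) (hM : 0 ≤ M)
    (h : s < G.density M) : G.conjDensity s ≤ M :=
  csSup_le ⟨0, G.zero_mem_sublevel hs⟩ fun _ ht => G.le_of_lt_density hM h ht

theorem lt_density_of_conjDensity_lt (G : NFunction) {s M : ℝ} (hM : 0 ≤ M)
    (h : G.conjDensity s < M) : s < G.density M := by
  by_contra! hle
  exact absurd (G.le_conjDensity hM hle) (not_le.2 h)

theorem conjDensity_nonneg (G : NFunction) {s : ℝ} (hs : 0 ≤ s) : 0 ≤ G.conjDensity s :=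
  G.le_conjDensity le_rfl (by rw [G.density_zero]; exact hs)

theorem conjDensity_mono (G : NFunction) : MonotoneOn G.conjDensity (Ici 0) := by
  intro a ha b _ hab
  exact csSup_le_csSup (G.bddAbove_sublevel b) ⟨0, G.zero_mem_sublevel ha⟩
    fun t ht => ⟨ht.1, ht.2.trans hab⟩

/-- The complementary (conjugate) N-function `G*`, with density `g*`. -/
def conj (G : NFunction) : NFunction where
  density := G.conjDensity
  density_zero := by
    refine le_antisymm ?_ (G.conjDensity_nonneg le_rfl)
    refine csSup_le ⟨0, G.zero_mem_sublevel le_rfl⟩ fun t ht => ?_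
    by_contra! h
    exact absurd ht.2 (not_le.2 (G.density_pos t h))
  density_pos := by
    intro s hs
    have h := G.density_rightCts 0 le_rfl
    have h1 : ∀ᶠ t in 𝓝[>] (0 : ℝ), G.density t < s :=
      (h.mono Ioi_subset_Ici_self).eventually_lt_const (by rw [G.density_zero]; exact hs)
    obtain ⟨t, h2, ht⟩ := (h1.and self_mem_nhdsWithin).exists
    exact lt_of_lt_of_le ht (G.le_conjDensity (le_of_lt ht) h2.le)
  density_mono := G.conjDensity_mono
  density_rightCts := by
    intro s hs
    have hx := G.conjDensity_nonneg hs
    refine tendsto_order.2 ⟨fun a ha => ?_, fun b hb => ?_⟩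
    · filter_upwards [self_mem_nhdsWithin] with r hr
      exact ha.trans_le (G.conjDensity_mono hs (hs.trans hr) hr)
    · obtain ⟨M, hM1, hM2⟩ := exists_between hb
      have hM : 0 ≤ M := hx.trans hM1.le
      filter_upwards [self_mem_nhdsWithin, mem_nhdsWithin_of_mem_nhds
        (Iio_mem_nhds (G.lt_density_of_conjDensity_lt hM hM1))] with r hr hr2
      exact (G.conjDensity_le (hs.trans hr) hM hr2).trans_lt hM2
  density_tendsto := by
    refine tendsto_atTop.2 fun M => ?_
    filter_upwards [eventually_ge_atTop (G.density (max M 0))] with s hs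
    exact (le_max_left M 0).trans (G.le_conjDensity (le_max_right M 0) hs)

/-- The condition `Δ₂` (at infinity): there are `k > 0` and `T ≥ 0` with `G(2t) ≤ k G(t)` for
all `t ≥ T`. -/
def Delta2 (G : NFunction) : Prop :=
  ∃ k : ℝ, 0 < k ∧ ∃ T : ℝ, 0 ≤ T ∧ ∀ t, T ≤ t → G.eval (2 * t) ≤ k * G.eval t

/-- The global condition `Δ₂,₀`: there is `k > 0` with `G(2t) ≤ k G(t)` for all `t ≥ 0`. -/
def Delta2Zero (G : NFunction) : Prop :=
  ∃ k : ℝ, 0 < k ∧ ∀ t, 0 ≤ t → G.eval (2 * t) ≤ k * G.eval t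

theorem eval_zero (G : NFunction) : G.eval 0 = 0 := by simp [eval]

theorem eval_le (G : NFunction) {t : ℝ} (h0 : 0 ≤ t) (h1 : t ≤ 1) :
    G.eval t ≤ G.density 1 * t := by
  have h : ‖∫ τ in (0 : ℝ)..t, G.density τ‖ ≤ G.density 1 * |t - 0| := by
    refine intervalIntegral.norm_integral_le_of_norm_le_const fun x hx => ?_
    rw [uIoc_of_le h0] at hx
    rw [Real.norm_of_nonneg (G.density_nonneg hx.1.le)]
    exact G.density_mono hx.1.le (zero_le_one' ℝ) (hx.2.trans h1)
  rw [sub_zero, abs_of_nonneg h0] at h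
  exact (Real.le_norm_self _).trans h

end NFunction

section Orlicz

variable {α : Type*} [MeasurableSpace α]

/-- The modular `ρ(u; G) = ∫ G(|u|) dμ`, with values in `[0, ∞]`. -/
def modular (G : NFunction) (μ : Measure α) (u : α → ℝ) : ℝ≥0∞ :=
  ∫⁻ x, ENNReal.ofReal (G.eval |u x|) ∂μ

/-- The Orlicz class `K^G`: the measurable functions with finite modular. -/
def orliczClass (G : NFunction) (μ : Measure α) : Set (α → ℝ) :=
  {u | Measurable u ∧ modular G μ u < ∞}

/-- The Orlicz norm `‖u‖_G = sup {∫ |u v| dμ : v ∈ K^{G*}, ρ(v; G*) ≤ 1}`, with values in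
`[0, ∞]`. -/
def orliczENorm (G : NFunction) (μ : Measure α) (u : α → ℝ) : ℝ≥0∞ :=
  ⨆ v ∈ {v | v ∈ orliczClass G.conj μ ∧ modular G.conj μ v ≤ 1}, ∫⁻ x, ‖u x * v x‖ₑ ∂μ

theorem orliczENorm_congr (G : NFunction) {μ : Measure α} {u w : α → ℝ} (h : u =ᵐ[μ] w) :
    orliczENorm G μ u = orliczENorm G μ w := by
  refine iSup_congr fun v => iSup_congr fun _ => lintegral_congr_ae ?_
  filter_upwards [h] with x hx
  rw [hx]

theorem orliczENorm_zero (G : NFunction) (μ : Measure α) : orliczENorm G μ (0 : α → ℝ) = 0 := by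
  simp [orliczENorm]

theorem orliczENorm_add_le (G : NFunction) {μ : Measure α} {u w : α → ℝ}
    (hu : AEStronglyMeasurable u μ) :
    orliczENorm G μ (u + w) ≤ orliczENorm G μ u + orliczENorm G μ w := by
  refine iSup₂_le fun v hv => ?_
  calc ∫⁻ x, ‖(u + w) x * v x‖ₑ ∂μ
      ≤ ∫⁻ x, (‖u x * v x‖ₑ + ‖w x * v x‖ₑ) ∂μ := by
        refine lintegral_mono fun x => ?_
        rw [Pi.add_apply, add_mul]
        exact enorm_add_le _ _
    _ = ∫⁻ x, ‖u x * v x‖ₑ ∂μ + ∫⁻ x, ‖w x * v x‖ₑ ∂μ :=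
        lintegral_add_left' (hu.aemeasurable.mul hv.1.1.aemeasurable).enorm _
    _ ≤ _ := add_le_add
        (le_iSup₂ (f := fun v (_ : v ∈ {v | v ∈ orliczClass G.conj μ ∧ modular G.conj μ v ≤ 1}) =>
          ∫⁻ x, ‖u x * v x‖ₑ ∂μ) v hv)
        (le_iSup₂ (f := fun v (_ : v ∈ {v | v ∈ orliczClass G.conj μ ∧ modular G.conj μ v ≤ 1}) =>
          ∫⁻ x, ‖w x * v x‖ₑ ∂μ) v hv)

theorem orliczENorm_smul (G : NFunction) {μ : Measure α} (c : ℝ) (u : α → ℝ) :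
    orliczENorm G μ (c • u) = ‖c‖ₑ * orliczENorm G μ u := by
  simp only [orliczENorm, ENNReal.mul_iSup]
  refine iSup_congr fun v => iSup_congr fun _ => ?_
  rw [← lintegral_const_mul' _ _ enorm_ne_top]
  refine lintegral_congr fun x => ?_
  rw [Pi.smul_apply, smul_eq_mul, mul_assoc, enorm_mul]

theorem ae_eq_zero_of_orliczENorm_eq_zero (G : NFunction) {μ : Measure α} [SigmaFinite μ]
    {u : α → ℝ} (hu : AEStronglyMeasurable u μ) (h : orliczENorm G μ u = 0) : u =ᵐ[μ] 0 := by
  refine ae_of_forall_measure_lt_top_ae_restrict _ fun s hs hμs => ?_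
  obtain ⟨k, hk0, hk1, hk⟩ : ∃ k : ℝ, 0 < k ∧ k ≤ 1 ∧ G.conj.density 1 * k * μ.real s ≤ 1 := by
    have hd : 0 ≤ G.conj.density 1 := G.conj.density_nonneg zero_le_one
    have hm : 0 ≤ μ.real s := measureReal_nonneg
    have hp : 0 ≤ G.conj.density 1 * μ.real s := mul_nonneg hd hm
    refine ⟨1 / (1 + G.conj.density 1 * μ.real s), by positivity, ?_, ?_⟩
    · rw [div_le_one (by positivity)]
      linarith
    · rw [mul_one_div, div_mul_eq_mul_div, div_le_one (by positivity)]
      linarith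
  have hv : Measurable (s.indicator fun _ : α => k) := measurable_const.indicator hs
  have hmod : modular G.conj μ (s.indicator fun _ => k) ≤ 1 := by
    have heq : (fun x => ENNReal.ofReal (G.conj.eval |s.indicator (fun _ => k) x|)) =
        s.indicator fun _ => ENNReal.ofReal (G.conj.eval k) := by
      funext x
      by_cases hx : x ∈ s
      · simp [hx, abs_of_pos hk0]
      · simp [hx, NFunction.eval_zero]
    rw [modular, heq, lintegral_indicator_const hs, ← ENNReal.ofReal_toReal hμs.ne,
      ← ENNReal.ofReal_mul' ENNReal.toReal_nonneg]
    refine ENNReal.ofReal_le_one.2 (le_trans ?_ hk)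
    exact mul_le_mul_of_nonneg_right (G.conj.eval_le hk0.le hk1) ENNReal.toReal_nonneg
  have hle : ∫⁻ x, ‖u x * s.indicator (fun _ => k) x‖ₑ ∂μ ≤ 0 := by
    rw [← h]
    exact le_iSup₂
      (f := fun v (_ : v ∈ {v | v ∈ orliczClass G.conj μ ∧ modular G.conj μ v ≤ 1}) =>
        ∫⁻ x, ‖u x * v x‖ₑ ∂μ) (s.indicator fun _ => k)
      ⟨⟨hv, hmod.trans_lt ENNReal.one_lt_top⟩, hmod⟩
  have hz := (lintegral_eq_zero_iff' (hu.aemeasurable.mul hv.aemeasurable).enorm).1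
    (le_antisymm hle bot_le)
  rw [ae_restrict_iff' hs]
  filter_upwards [hz] with x hx hxs
  simpa [hxs, hk0.ne'] using hx

/-- The Orlicz space `L^G`: the classes, for equality almost everywhere, of measurable functions
with finite Orlicz norm. -/
def OrliczSpace (G : NFunction) (μ : Measure α) : Submodule ℝ (α →ₘ[μ] ℝ) where
  carrier := {u | orliczENorm G μ u < ∞}
  zero_mem' := by
    rw [mem_ofPred_eq, orliczENorm_congr G AEEqFun.coeFn_zero, orliczENorm_zero]
    exact ENNReal.zero_lt_top
  add_mem' := by
    intro u w hu hw
    rw [mem_ofPred_eq, orliczENorm_congr G (AEEqFun.coeFn_add u w)]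
    exact (orliczENorm_add_le G u.aestronglyMeasurable).trans_lt (ENNReal.add_lt_top.2 ⟨hu, hw⟩)
  smul_mem' := by
    intro c u hu
    rw [mem_ofPred_eq, orliczENorm_congr G (AEEqFun.coeFn_smul c u), orliczENorm_smul]
    exact ENNReal.mul_lt_top enorm_lt_top hu

namespace OrliczSpace

variable {G : NFunction} {μ : Measure α}

instance instNorm : Norm (OrliczSpace G μ) :=
  ⟨fun u => (orliczENorm G μ (u : α →ₘ[μ] ℝ)).toReal⟩

theorem norm_def (u : OrliczSpace G μ) :
    ‖u‖ = (orliczENorm G μ (u : α →ₘ[μ] ℝ)).toReal := rfl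

theorem norm_smul_eq (c : ℝ) (u : OrliczSpace G μ) : ‖c • u‖ = ‖c‖ * ‖u‖ := by
  rw [norm_def, norm_def, Submodule.coe_smul, orliczENorm_congr G (AEEqFun.coeFn_smul c _),
    orliczENorm_smul, ENNReal.toReal_mul, toReal_enorm]

instance instNormedAddCommGroup [SigmaFinite μ] : NormedAddCommGroup (OrliczSpace G μ) :=
  AddGroupNorm.toNormedAddCommGroup
    { toFun := fun u => ‖u‖
      map_zero' := by
        rw [norm_def, Submodule.coe_zero, orliczENorm_congr G AEEqFun.coeFn_zero,
          orliczENorm_zero, ENNReal.toReal_zero]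
      add_le' := fun u w => by
        rw [norm_def, norm_def, norm_def, Submodule.coe_add,
          orliczENorm_congr G (AEEqFun.coeFn_add _ _),
          ← ENNReal.toReal_add u.2.ne w.2.ne]
        exact ENNReal.toReal_mono (ENNReal.add_ne_top.2 ⟨u.2.ne, w.2.ne⟩)
          (orliczENorm_add_le G (u : α →ₘ[μ] ℝ).aestronglyMeasurable)
      neg' := fun u => by
        have h := norm_smul_eq (-1) u
        rwa [neg_one_smul ℝ u, norm_neg (1 : ℝ), norm_one, one_mul] at h
      eq_zero_of_map_eq_zero' := fun u hu => by
        rw [norm_def, ENNReal.toReal_eq_zero_iff] at hu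
        have h := ae_eq_zero_of_orliczENorm_eq_zero G
          (u : α →ₘ[μ] ℝ).aestronglyMeasurable (hu.resolve_right u.2.ne)
        exact Subtype.ext (AEEqFun.ext (h.trans AEEqFun.coeFn_zero.symm)) }

instance instNormedSpace [SigmaFinite μ] : NormedSpace ℝ (OrliczSpace G μ) where
  norm_smul_le c u := (norm_smul_eq c u).le

end OrliczSpace

end Orlicz

/-- A real normed space is reflexive if the canonical map into its bidual is surjective. -/
def IsReflexiveSpace (X : Type*) [NormedAddCommGroup X] [NormedSpace ℝ X] : Prop :=
  Function.Surjective (NormedSpace.inclusionInDoubleDual ℝ X)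

end

/-! The proof passes through an intermediate property, `HasFiniteModular`: finite norm forces finite
modular. For every σ-finite measure, `L^G` is reflexive exactly when this property holds for both
`G` and `G*`; only the comparison with the growth conditions uses the geometry of `Ω`.

Sufficiency. Finite modular gives dominated convergence in norm (`tendsto_toSpace`). A functional
then defines a countably additive set function, and Radon–Nikodym turns it into integration against
a function, which lies in `L^{G*}` (`exists_representation`). So the dual of `L^G` is `L^{G*}`, and
since `G** = G` the dual of `L^{G*}` is `L^G`, through the same pairing.

Necessity. An element of infinite modular stays at distance at least 1/2 from the heart, the
subspace whose multiples all have finite modular, so Hahn–Banach gives a nonzero functional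
vanishing on the heart. The heart contains the truncations and the indicators of sets of finite
measure, which determine an element by integration. Reflexivity contradicts this: for `G` through a
weak limit of truncations, for `G*` by representing a bidual functional as evaluation at a point.

Growth. The growth condition gives finite modular by repeated doubling. If it fails, there are `t n`
with `G(2 t n) > 2^n G(t n)`; a step function taking these values on disjoint shells of suitable
measure has finite modular, while its double does not. -/

namespace NFunction

/-! ### N-functions: subgradients, Young's inequality and biconjugation -/

theorem intervalIntegrable_density (G : NFunction) {a b : ℝ} (ha : 0 ≤ a) (hb : 0 ≤ b) :
    IntervalIntegrable G.density volume a b :=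
  (G.density_mono.mono fun _ hx => (le_min ha hb).trans hx.1).intervalIntegrable

theorem eval_sub_eval (G : NFunction) {a b : ℝ} (ha : 0 ≤ a) (hb : 0 ≤ b) :
    G.eval b - G.eval a = ∫ τ in a..b, G.density τ :=
  intervalIntegral.integral_interval_sub_left (G.intervalIntegrable_density le_rfl hb)
    (G.intervalIntegrable_density le_rfl ha)

/-- Every value between the one-sided limits of the density is a subgradient. -/
theorem mul_le_eval_sub_eval (G : NFunction) {a b s : ℝ} (ha : 0 ≤ a) (hb : 0 ≤ b)
    (h1 : ∀ t, 0 ≤ t → t < a → G.density t ≤ s) (h2 : ∀ t, a < t → s ≤ G.density t) :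
    s * (b - a) ≤ G.eval b - G.eval a := by
  rw [G.eval_sub_eval ha hb]
  rcases le_total a b with hab | hab
  · have h := intervalIntegral.integral_mono_on_of_le_Ioo hab
      (intervalIntegrable_const (c := s) (μ := volume))
      (G.intervalIntegrable_density ha hb) (fun t ht => h2 t ht.1)
    rw [intervalIntegral.integral_const, smul_eq_mul] at h
    linarith
  · have h := intervalIntegral.integral_mono_on_of_le_Ioo hab
      (G.intervalIntegrable_density hb ha) (intervalIntegrable_const (c := s) (μ := volume))
      (fun t ht => h1 t (hb.trans ht.1.le) ht.2)
    rw [intervalIntegral.integral_const, smul_eq_mul] at h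
    rw [intervalIntegral.integral_symm]
    linarith

theorem density_mul_le (G : NFunction) {a b : ℝ} (ha : 0 ≤ a) (hb : 0 ≤ b) :
    G.density a * (b - a) ≤ G.eval b - G.eval a :=
  G.mul_le_eval_sub_eval ha hb (fun _ ht hta => G.density_mono ht ha hta.le)
    fun _ hat => G.density_mono ha (ha.trans hat.le) hat.le

theorem eval_mono (G : NFunction) : MonotoneOn G.eval (Ici 0) := by
  intro a ha b hb hab
  have h1 := G.density_mul_le ha hb
  have h2 := mul_nonneg (G.density_nonneg ha) (sub_nonneg.2 hab)
  linarith

theorem eval_nonneg (G : NFunction) {t : ℝ} (ht : 0 ≤ t) : 0 ≤ G.eval t := by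
  rw [← G.eval_zero]
  exact G.eval_mono self_mem_Ici ht ht

theorem eval_pos (G : NFunction) {t : ℝ} (ht : 0 < t) : 0 < G.eval t := by
  have h1 := G.density_mul_le (half_pos ht).le ht.le
  have h2 := mul_pos (G.density_pos _ (half_pos ht)) (half_pos ht)
  have h3 := G.eval_nonneg (half_pos ht).le
  nlinarith

theorem convexOn_eval (G : NFunction) : ConvexOn ℝ (Ici 0) G.eval := by
  refine ⟨convex_Ici 0, fun a ha b hb p q hp hq hpq => ?_⟩
  have hc : 0 ≤ p • a + q • b := (convex_Ici (0 : ℝ)) ha hb hp hq hpq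
  have h1 := mul_le_mul_of_nonneg_left (G.density_mul_le hc ha) hp
  have h2 := mul_le_mul_of_nonneg_left (G.density_mul_le hc hb) hq
  simp only [smul_eq_mul] at *
  obtain rfl : q = 1 - p := by linarith
  linarith

theorem eval_mul_le (G : NFunction) {c t : ℝ} (hc : 0 ≤ c) (hc1 : c ≤ 1) (ht : 0 ≤ t) :
    G.eval (c * t) ≤ c * G.eval t := by
  have h := G.convexOn_eval.2 (mem_Ici.2 ht) (self_mem_Ici (a := (0 : ℝ))) hc
    (sub_nonneg.2 hc1) (by ring)
  simpa [G.eval_zero] using h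

/-- Convexity at the midpoint of `2a` and `2b`, with the factor 1/2 discarded. -/
theorem eval_add_le (G : NFunction) {a b : ℝ} (ha : 0 ≤ a) (hb : 0 ≤ b) :
    G.eval (a + b) ≤ G.eval (2 * a) + G.eval (2 * b) := by
  have h := G.convexOn_eval.2 (mem_Ici.2 (by positivity : 0 ≤ 2 * a))
    (mem_Ici.2 (by positivity : 0 ≤ 2 * b)) (by norm_num : (0 : ℝ) ≤ 1 / 2)
    (by norm_num : (0 : ℝ) ≤ 1 / 2) (by norm_num)
  have e : (1 / 2 : ℝ) • (2 * a) + (1 / 2 : ℝ) • (2 * b) = a + b := by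
    simp only [smul_eq_mul]; ring
  rw [e, smul_eq_mul, smul_eq_mul] at h
  have h1 := G.eval_nonneg (by positivity : 0 ≤ 2 * a)
  have h2 := G.eval_nonneg (by positivity : 0 ≤ 2 * b)
  linarith

theorem measurable_density_comp {α : Type*} [MeasurableSpace α] (G : NFunction) {u : α → ℝ}
    (hu : Measurable u) : Measurable fun x => G.density |u x| := by
  -- Values at negative arguments are unconstrained, so the density is globally monotone only after
  -- clamping at `0`.
  have h : Monotone fun t => G.density (max t 0) := fun a b hab =>
    G.density_mono (le_max_right a 0) (le_max_right b 0) (max_le_max_right 0 hab)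
  have h2 := h.measurable.comp hu.norm
  simpa [Function.comp_def] using h2

theorem measurable_eval_comp {α : Type*} [MeasurableSpace α] (G : NFunction) {u : α → ℝ}
    (hu : Measurable u) : Measurable fun x => G.eval |u x| := by
  have h : Monotone fun t => G.eval (max t 0) := fun a b hab =>
    G.eval_mono (le_max_right a 0) (le_max_right b 0) (max_le_max_right 0 hab)
  have h2 := h.measurable.comp hu.norm
  simpa [Function.comp_def] using h2

theorem eval_tendsto (G : NFunction) : Tendsto G.eval atTop atTop := by
  have h : Tendsto (fun t => G.density 1 * (t - 1)) atTop atTop :=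
    (tendsto_atTop_add_const_right _ (-1) tendsto_id).const_mul_atTop (G.density_pos 1 one_pos)
  refine tendsto_atTop_mono' _ ?_ h
  filter_upwards [eventually_ge_atTop 0] with t ht
  have h1 := G.density_mul_le zero_le_one ht
  have h2 := G.eval_nonneg zero_le_one
  linarith

/-- A function vanishing at `0` and having the density as a subgradient is the N-function. -/
theorem eval_eq_of_subgradient (G : NFunction) {φ : ℝ → ℝ} (h0 : φ 0 = 0)
    (hφ : ∀ a b, 0 ≤ a → 0 ≤ b → G.density a * (b - a) ≤ φ b - φ a) {t : ℝ} (ht : 0 ≤ t) :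
    φ t = G.eval t := by
  -- Subgradients on `[0, t]` are bounded by `g(t)`, so `φ` is Lipschitz there.
  have hcont : ContinuousOn φ (uIcc 0 t) := by
    rw [uIcc_of_le ht]
    refine (LipschitzOnWith.of_dist_le_mul (K := (G.density t).toNNReal)
      fun a ha b hb => ?_).continuousOn
    have key : ∀ a b, a ∈ Icc 0 t → b ∈ Icc 0 t → φ b - φ a ≤ G.density t * |b - a| := by
      intro a b ha hb
      have h1 := hφ b a hb.1 ha.1
      have h2 := mul_le_mul_of_nonneg_left (le_abs_self (b - a)) (G.density_nonneg hb.1)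
      have h3 := mul_le_mul_of_nonneg_right (G.density_mono hb.1 ht hb.2) (abs_nonneg (b - a))
      linarith
    rw [Real.dist_eq, Real.dist_eq, Real.coe_toNNReal _ (G.density_nonneg ht),
      abs_sub_le_iff]
    exact ⟨key b a hb ha, by rw [abs_sub_comm]; exact key a b ha hb⟩
  -- The slope between `x` and `y > x` lies between `g(x)` and `g(y)`; right-continuity makes `g(x)`
  -- the right derivative.
  have hderiv : ∀ x ∈ Ioo (min 0 t) (max 0 t), HasDerivWithinAt φ (G.density x) (Ioi x) x := by
    intro x hx
    rw [min_eq_left ht, max_eq_right ht] at hx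
    rw [hasDerivWithinAt_iff_tendsto_slope' self_notMem_Ioi]
    refine tendsto_of_tendsto_of_tendsto_of_le_of_le' tendsto_const_nhds
      ((G.density_rightCts x hx.1.le).mono Ioi_subset_Ici_self) ?_ ?_
    · filter_upwards [self_mem_nhdsWithin] with y hy
      have hy' : 0 < y - x := sub_pos.2 hy
      rw [slope_def_field, le_div_iff₀ hy']
      exact hφ x y hx.1.le (hx.1.trans hy).le
    · filter_upwards [self_mem_nhdsWithin] with y hy
      have hy' : 0 < y - x := sub_pos.2 hy
      rw [slope_def_field, div_le_iff₀ hy']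
      have := hφ y x (hx.1.trans hy).le hx.1.le
      linarith
  have h := intervalIntegral.integral_eq_sub_of_hasDeriv_right hcont hderiv
    (G.intervalIntegrable_density le_rfl ht)
  rw [eval, h, h0, sub_zero]

theorem density_le_of_lt_conjDensity (G : NFunction) {s t : ℝ} (ht : 0 ≤ t)
    (h : t < G.conjDensity s) : G.density t ≤ s := by
  have hne : (G.sublevel s).Nonempty := by
    -- The sublevel set can be empty when `s < 0`; its supremum is then `0` by convention.
    by_contra hne
    rw [not_nonempty_iff_eq_empty] at hne
    rw [conjDensity, hne, Real.sSup_empty] at h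
    exact absurd ht (not_le.2 h)
  obtain ⟨r, hr, htr⟩ := exists_lt_of_lt_csSup hne h
  exact (G.density_mono ht hr.1 htr.le).trans hr.2

/-- `s` lies between the one-sided limits of `g` at `g*(s)`, so it is a subgradient of `G` there:
the Legendre supremum of `s t - G(t)` is attained at `t = g*(s)`. -/
theorem mul_sub_eval_le (G : NFunction) {s t : ℝ} (hs : 0 ≤ s) (ht : 0 ≤ t) :
    s * t - G.eval t ≤ s * G.conjDensity s - G.eval (G.conjDensity s) := by
  have h := G.mul_le_eval_sub_eval (s := s) (G.conjDensity_nonneg hs) ht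
    (fun r hr h => G.density_le_of_lt_conjDensity hr h)
    (fun r hr => (G.lt_density_of_conjDensity_lt ((G.conjDensity_nonneg hs).trans hr.le) hr).le)
  linarith

/-- The right side is the Legendre transform of `G`. Using `g*(a)` as a competitor in the supremum
at `b` shows that `g*(a)` is a subgradient at `a`, which identifies the transform with the integral
of `g*`. -/
theorem eval_conj (G : NFunction) {s : ℝ} (hs : 0 ≤ s) :
    G.conj.eval s = s * G.conjDensity s - G.eval (G.conjDensity s) := by
  refine (G.conj.eval_eq_of_subgradient
    (φ := fun s => s * G.conjDensity s - G.eval (G.conjDensity s)) ?_ ?_ hs).symm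
  · have h : G.conjDensity 0 = 0 := G.conj.density_zero
    simp [h, G.eval_zero]
  · intro a b ha hb
    have h := G.mul_sub_eval_le hb (G.conjDensity_nonneg ha)
    have e : G.conj.density a = G.conjDensity a := rfl
    rw [e]
    linarith

/-- Young's inequality. -/
theorem young (G : NFunction) {s t : ℝ} (ht : 0 ≤ t) (hs : 0 ≤ s) :
    t * s ≤ G.eval t + G.conj.eval s := by
  have h := G.mul_sub_eval_le hs ht
  rw [G.eval_conj hs]
  linarith

/-- The case of equality in Young's inequality. -/
theorem young_eq (G : NFunction) {t : ℝ} (ht : 0 ≤ t) :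
    t * G.density t = G.eval t + G.conj.eval (G.density t) := by
  have hs := G.density_nonneg ht
  refine le_antisymm (G.young ht hs) ?_
  have h := G.density_mul_le ht (G.conjDensity_nonneg hs)
  rw [G.eval_conj hs]
  linarith

/-- Right-continuity is what recovers `g` itself: `g*(s) ≤ t` bounds `s` by `g(r)` for every `r >
t`, hence by `g(t)`. -/
theorem conj_conj_density (G : NFunction) {t : ℝ} (ht : 0 ≤ t) :
    G.conj.conj.density t = G.density t := by
  have hg := G.density_nonneg ht
  refine le_antisymm ?_ (le_of_forall_lt_imp_le_of_dense fun s hs => ?_)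
  · refine csSup_le ⟨0, G.conj.zero_mem_sublevel ht⟩ fun s hs => ?_
    have h1 : ∀ᶠ r in 𝓝[>] t, s ≤ G.density r := by
      filter_upwards [self_mem_nhdsWithin] with r hr
      exact (G.lt_density_of_conjDensity_lt (ht.trans (le_of_lt hr))
        (lt_of_le_of_lt hs.2 hr)).le
    exact ge_of_tendsto ((G.density_rightCts t ht).mono Ioi_subset_Ici_self) h1
  · rcases le_or_gt 0 s with h0 | h0
    · exact G.conj.le_conjDensity h0 (G.conjDensity_le h0 ht hs)
    · exact h0.le.trans (G.conj.conjDensity_nonneg ht)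

theorem conj_conj_eval (G : NFunction) {t : ℝ} (ht : 0 ≤ t) : G.conj.conj.eval t = G.eval t := by
  refine intervalIntegral.integral_congr fun x hx => ?_
  rw [uIcc_of_le ht] at hx
  exact G.conj_conj_density hx.1

end NFunction

/-! ### Norm against modular: unit balls, Hölder's inequality, growth conditions -/

section Orlicz

variable {α : Type*} [MeasurableSpace α] {G : NFunction} {μ : Measure α}

theorem le_orliczENorm {u v : α → ℝ} (hv : Measurable v) (h : modular G.conj μ v ≤ 1) :
    ∫⁻ x, ‖u x * v x‖ₑ ∂μ ≤ orliczENorm G μ u :=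
  le_iSup₂ (f := fun v (_ : v ∈ {v | v ∈ orliczClass G.conj μ ∧ modular G.conj μ v ≤ 1}) =>
    ∫⁻ x, ‖u x * v x‖ₑ ∂μ) v ⟨⟨hv, h.trans_lt ENNReal.one_lt_top⟩, h⟩

theorem orliczENorm_mono {u w : α → ℝ} (h : ∀ᵐ x ∂μ, |u x| ≤ |w x|) :
    orliczENorm G μ u ≤ orliczENorm G μ w := by
  refine iSup₂_mono fun v _ => lintegral_mono_ae ?_
  filter_upwards [h] with x hx
  rw [enorm_mul, enorm_mul, Real.enorm_eq_ofReal_abs (u x), Real.enorm_eq_ofReal_abs (w x)]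
  exact mul_le_mul_left (ENNReal.ofReal_le_ofReal hx) _

theorem modular_congr {u w : α → ℝ} (h : u =ᵐ[μ] w) : modular G μ u = modular G μ w := by
  refine lintegral_congr_ae ?_
  filter_upwards [h] with x hx
  rw [hx]

theorem modular_conj_conj (u : α → ℝ) : modular G.conj.conj μ u = modular G μ u := by
  refine lintegral_congr fun x => ?_
  rw [G.conj_conj_eval (abs_nonneg _)]

theorem modular_add_le {u w : α → ℝ} (hu : Measurable u) :
    modular G μ (u + w) ≤ modular G μ ((2 : ℝ) • u) + modular G μ ((2 : ℝ) • w) := by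
  have hm : Measurable fun x => ENNReal.ofReal (G.eval |((2 : ℝ) • u) x|) :=
    (G.measurable_eval_comp (hu.const_smul (2 : ℝ))).ennreal_ofReal
  rw [modular, modular, modular, ← lintegral_add_left hm]
  refine lintegral_mono fun x => ?_
  rw [← ENNReal.ofReal_add (G.eval_nonneg (abs_nonneg _)) (G.eval_nonneg (abs_nonneg _))]
  refine ENNReal.ofReal_le_ofReal ?_
  simp only [Pi.add_apply, Pi.smul_apply, smul_eq_mul, abs_mul, abs_two]
  exact (G.eval_mono (mem_Ici.2 (abs_nonneg _)) (mem_Ici.2 (by positivity)) (abs_add_le _ _)).trans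
    (G.eval_add_le (abs_nonneg _) (abs_nonneg _))

theorem modular_smul_le {c : ℝ} (hc : 0 ≤ c) (hc1 : c ≤ 1) (u : α → ℝ) :
    modular G μ (c • u) ≤ ENNReal.ofReal c * modular G μ u := by
  rw [modular, modular, ← lintegral_const_mul' _ _ ENNReal.ofReal_ne_top]
  refine lintegral_mono fun x => ?_
  rw [← ENNReal.ofReal_mul hc, Pi.smul_apply, smul_eq_mul, abs_mul, abs_of_nonneg hc]
  exact ENNReal.ofReal_le_ofReal (G.eval_mul_le hc hc1 (abs_nonneg _))

theorem modular_lt_top_of_bounded {u : α → ℝ} {s : Set α} (hs : MeasurableSet s)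
    (hμs : μ s < ∞) {M : ℝ} (hM : ∀ x, |u x| ≤ M) (h0 : ∀ x, x ∉ s → u x = 0) :
    modular G μ u < ∞ := by
  calc modular G μ u ≤ ∫⁻ x, s.indicator (fun _ => ENNReal.ofReal (G.eval M)) x ∂μ := by
        refine lintegral_mono fun x => ?_
        by_cases hx : x ∈ s
        · rw [indicator_of_mem hx]
          exact ENNReal.ofReal_le_ofReal
            (G.eval_mono (mem_Ici.2 (abs_nonneg _)) (mem_Ici.2 ((abs_nonneg _).trans (hM x))) (hM x))
        · simp [h0 x hx, G.eval_zero]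
    _ = ENNReal.ofReal (G.eval M) * μ s := lintegral_indicator_const hs _
    _ < ∞ := ENNReal.mul_lt_top ENNReal.ofReal_lt_top hμs

/-- Young's inequality, integrated against each admissible `v`. -/
theorem orliczENorm_le_one_add_modular {u : α → ℝ} (hu : Measurable u) :
    orliczENorm G μ u ≤ modular G μ u + 1 := by
  refine iSup₂_le fun v hv => ?_
  have hm : Measurable fun x => ENNReal.ofReal (G.eval |u x|) :=
    (G.measurable_eval_comp hu).ennreal_ofReal
  calc ∫⁻ x, ‖u x * v x‖ₑ ∂μ
      ≤ ∫⁻ x, (ENNReal.ofReal (G.eval |u x|) + ENNReal.ofReal (G.conj.eval |v x|)) ∂μ := by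
        refine lintegral_mono fun x => ?_
        rw [← ENNReal.ofReal_add (G.eval_nonneg (abs_nonneg _))
          (G.conj.eval_nonneg (abs_nonneg _)), Real.enorm_eq_ofReal_abs, abs_mul]
        exact ENNReal.ofReal_le_ofReal (G.young (abs_nonneg _) (abs_nonneg _))
    _ = modular G μ u + modular G.conj μ v := lintegral_add_left hm _
    _ ≤ _ := by gcongr; exact hv.2

theorem orliczENorm_inv_smul_le {u : α → ℝ} {c : ℝ} (hc : 0 < c)
    (h : orliczENorm G μ u ≤ ENNReal.ofReal c) :
    orliczENorm G μ (c⁻¹ • u) ≤ 1 := by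
  rw [orliczENorm_smul, Real.enorm_of_nonneg (inv_nonneg.2 hc.le), ENNReal.ofReal_inv_of_pos hc]
  exact (mul_le_mul_right h _).trans (ENNReal.inv_mul_le_one _)

/-- The truncation of `u` to height `n` on the `n`-th spanning set. -/
noncomputable def truncation (μ : Measure α) [SigmaFinite μ] (u : α → ℝ) (n : ℕ) : α → ℝ :=
  (spanningSets μ n ∩ {x | |u x| ≤ n}).indicator u

section Truncation

variable [SigmaFinite μ] {u : α → ℝ}

theorem measurable_truncation (hu : Measurable u) (n : ℕ) : Measurable (truncation μ u n) :=
  hu.indicator ((measurableSet_spanningSets μ n).inter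
    (measurableSet_le hu.norm measurable_const))

theorem abs_truncation_le (u : α → ℝ) (n : ℕ) (x : α) : |truncation μ u n x| ≤ |u x| := by
  rw [truncation, indicator]
  split_ifs <;> simp

theorem abs_truncation_le_nat (u : α → ℝ) (n : ℕ) (x : α) : |truncation μ u n x| ≤ n := by
  rw [truncation, indicator]
  split_ifs with h
  · exact h.2
  · simp

theorem truncation_eq_zero (u : α → ℝ) {n : ℕ} {x : α} (h : x ∉ spanningSets μ n) :
    truncation μ u n x = 0 :=
  indicator_of_notMem (fun hx => h hx.1) _

theorem truncation_eventuallyEq (u : α → ℝ) (x : α) :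
    ∀ᶠ n in atTop, truncation μ u n x = u x := by
  obtain ⟨k, hk⟩ := mem_iUnion.1 ((iUnion_spanningSets μ).symm ▸ mem_univ x)
  filter_upwards [eventually_ge_atTop k, eventually_ge_atTop ⌈|u x|⌉₊] with n h1 h2
  have hx : |u x| ≤ n := (Nat.le_ceil _).trans (by exact_mod_cast h2)
  exact indicator_of_mem (show x ∈ _ ∩ {x | |u x| ≤ n} from
    ⟨monotone_spanningSets μ h1 hk, hx⟩) _

theorem modular_smul_truncation_lt_top (c : ℝ) (u : α → ℝ) (n : ℕ) :
    modular G μ (c • truncation μ u n) < ∞ := by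
  refine modular_lt_top_of_bounded (measurableSet_spanningSets μ n)
    (measure_spanningSets_lt_top μ n) (M := |c| * n) (fun x => ?_) fun x hx => ?_
  · rw [Pi.smul_apply, smul_eq_mul, abs_mul]
    exact mul_le_mul_of_nonneg_left (abs_truncation_le_nat u n x) (abs_nonneg c)
  · rw [Pi.smul_apply, truncation_eq_zero u hx, smul_zero]

/-- The test function `v = g(|w|)` gives equality in Young's inequality, so `∫ |w v| = ρ(w; G) + R`
with `R = ρ(v; G*)`. Truncation serves to make `R` finite, so that it can be cancelled. -/
theorem modular_truncation_le_one (hu : Measurable u) (h : orliczENorm G μ u ≤ 1) (n : ℕ) :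
    modular G μ (truncation μ u n) ≤ 1 := by
  set w := truncation μ u n with hw
  have hwm : Measurable w := measurable_truncation hu n
  set v : α → ℝ := fun x => G.density |w x| with hv
  have hvm : Measurable v := G.measurable_density_comp hwm
  have hv0 : ∀ x, 0 ≤ v x := fun x => G.density_nonneg (abs_nonneg _)
  set R := modular G.conj μ v with hR
  have hRfin : R < ∞ := by
    refine modular_lt_top_of_bounded (measurableSet_spanningSets μ n)
      (measure_spanningSets_lt_top μ n) (M := G.density n) (fun x => ?_) fun x hx => ?_
    · rw [abs_of_nonneg (hv0 x)]
      exact G.density_mono (mem_Ici.2 (abs_nonneg _)) (mem_Ici.2 (Nat.cast_nonneg n)) (abs_truncation_le_nat u n x)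
    · simp [hv, hw, truncation_eq_zero u hx, G.density_zero]
  have hsum : ∫⁻ x, ‖w x * v x‖ₑ ∂μ = modular G μ w + R := by
    rw [hR, modular, modular,
      ← lintegral_add_left (G.measurable_eval_comp hwm).ennreal_ofReal]
    refine lintegral_congr fun x => ?_
    rw [← ENNReal.ofReal_add (G.eval_nonneg (abs_nonneg _)) (G.conj.eval_nonneg (abs_nonneg _)),
      Real.enorm_eq_ofReal_abs, abs_mul, abs_of_nonneg (hv0 x)]
    exact congrArg _ (G.young_eq (abs_nonneg (w x)))
  -- By convexity `v / r` is admissible, hence `∫ |w v| ≤ r ≤ 1 + R`.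
  set r : ℝ := max R.toReal 1 with hr
  have hr1 : 1 ≤ r := le_max_right _ _
  have hr0 : 0 < r := one_pos.trans_le hr1
  have hRr : R ≤ ENNReal.ofReal r :=
    (ENNReal.le_ofReal_iff_toReal_le hRfin.ne hr0.le).2 (le_max_left _ _)
  have hmod : modular G.conj μ (r⁻¹ • v) ≤ 1 := by
    refine (modular_smul_le (inv_nonneg.2 hr0.le) (inv_le_one_of_one_le₀ hr1) v).trans ?_
    rw [ENNReal.ofReal_inv_of_pos hr0]
    exact (mul_le_mul_right hRr _).trans (ENNReal.inv_mul_le_one _)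
  have h1 : ∫⁻ x, ‖w x * v x‖ₑ ∂μ ≤ ENNReal.ofReal r := by
    have e : ∀ x, ‖w x * v x‖ₑ = ENNReal.ofReal r * ‖w x * (r⁻¹ • v) x‖ₑ := by
      intro x
      rw [← Real.enorm_of_nonneg hr0.le, ← enorm_mul, Pi.smul_apply, smul_eq_mul]
      congr 1
      field_simp
    simp only [e]
    rw [lintegral_const_mul' _ _ ENNReal.ofReal_ne_top]
    calc _ ≤ ENNReal.ofReal r * 1 := by
          gcongr
          exact (le_orliczENorm (hvm.const_smul r⁻¹) hmod).trans
            ((orliczENorm_mono (ae_of_all _ (abs_truncation_le u n))).trans h)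
      _ = _ := mul_one _
  rw [hsum] at h1
  have h2 : ENNReal.ofReal r ≤ 1 + R := by
    rw [← ENNReal.ofReal_toReal hRfin.ne, ← ENNReal.ofReal_one,
      ← ENNReal.ofReal_add zero_le_one ENNReal.toReal_nonneg]
    refine ENNReal.ofReal_le_ofReal (max_le ?_ ?_)
    · linarith
    · linarith [ENNReal.toReal_nonneg (a := R)]
  exact (ENNReal.add_le_add_iff_right hRfin.ne).1 (h1.trans h2)

/-- The unit ball of the Orlicz norm is contained in that of the modular. -/
theorem modular_le_one (hu : Measurable u) (h : orliczENorm G μ u ≤ 1) : modular G μ u ≤ 1 := by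
  have hlim : ∀ x, Tendsto (fun n => ENNReal.ofReal (G.eval |truncation μ u n x|)) atTop
      (𝓝 (ENNReal.ofReal (G.eval |u x|))) := fun x =>
    tendsto_const_nhds.congr' ((truncation_eventuallyEq (μ := μ) u x).mono fun n hn => by simp only [hn])
  calc modular G μ u
      = ∫⁻ x, liminf (fun n => ENNReal.ofReal (G.eval |truncation μ u n x|)) atTop ∂μ :=
        lintegral_congr fun x => (hlim x).liminf_eq.symm
    _ ≤ liminf (fun n => modular G μ (truncation μ u n)) atTop :=
        lintegral_liminf_le fun n =>
          (G.measurable_eval_comp (measurable_truncation hu n)).ennreal_ofReal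
    _ ≤ 1 := liminf_le_of_le (by isBoundedDefault) fun b hb => by
        obtain ⟨n, hn⟩ := hb.exists
        exact hn.trans (modular_truncation_le_one hu h n)

/-- Hölder's inequality. -/
theorem lintegral_enorm_mul_le {v : α → ℝ} (hv : Measurable v)
    (hfin : orliczENorm G.conj μ v < ∞) :
    ∫⁻ x, ‖u x * v x‖ₑ ∂μ ≤ orliczENorm G μ u * orliczENorm G.conj μ v := by
  rcases eq_or_ne (orliczENorm G.conj μ v) 0 with h0 | h0
  · have hz := ae_eq_zero_of_orliczENorm_eq_zero G.conj hv.aestronglyMeasurable h0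
    have : ∫⁻ x, ‖u x * v x‖ₑ ∂μ = ∫⁻ _, 0 ∂μ :=
      lintegral_congr_ae (by filter_upwards [hz] with x hx; simp [hx])
    rw [this, lintegral_zero]
    exact bot_le
  · set c := (orliczENorm G.conj μ v).toReal with hc
    have hc0 : 0 < c := ENNReal.toReal_pos h0 hfin.ne
    have hce : ENNReal.ofReal c = orliczENorm G.conj μ v := ENNReal.ofReal_toReal hfin.ne
    have hmod := modular_le_one (hv.const_smul c⁻¹) (orliczENorm_inv_smul_le hc0 hce.ge)
    have e : ∀ x, ‖u x * v x‖ₑ = ENNReal.ofReal c * ‖u x * (c⁻¹ • v) x‖ₑ := by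
      intro x
      rw [← Real.enorm_of_nonneg hc0.le, ← enorm_mul, Pi.smul_apply, smul_eq_mul]
      congr 1
      field_simp
    simp only [e]
    rw [lintegral_const_mul' _ _ ENNReal.ofReal_ne_top, mul_comm, hce]
    gcongr
    exact le_orliczENorm (hv.const_smul c⁻¹) hmod

end Truncation

/-- Every measurable function of finite Orlicz norm has finite modular. -/
def HasFiniteModular (G : NFunction) (μ : Measure α) : Prop :=
  ∀ u : α → ℝ, Measurable u → orliczENorm G μ u < ∞ → modular G μ u < ∞

theorem exists_modular_pow_smul_le_one [SigmaFinite μ] {u : α → ℝ} (hu : Measurable u)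
    (h : orliczENorm G μ u < ∞) :
    ∃ j : ℕ, modular G μ ((2 ^ j : ℝ)⁻¹ • u) ≤ 1 := by
  obtain ⟨j, hj⟩ := pow_unbounded_of_one_lt (orliczENorm G μ u).toReal one_lt_two
  refine ⟨j, modular_le_one (hu.const_smul _) (orliczENorm_inv_smul_le (by positivity) ?_)⟩
  exact (ENNReal.le_ofReal_iff_toReal_le h.ne (by positivity)).2 hj.le

/-- Some `2^(-j) u` lies in the unit ball of the modular; doubling it `j` times returns to `u`. -/
theorem hasFiniteModular_of_modular_two_smul [SigmaFinite μ]
    (h : ∀ u : α → ℝ, Measurable u → modular G μ u < ∞ → modular G μ ((2 : ℝ) • u) < ∞) :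
    HasFiniteModular G μ := by
  intro u hu hfin
  obtain ⟨j, hj⟩ := exists_modular_pow_smul_le_one hu hfin
  have key : ∀ i : ℕ, modular G μ ((2 : ℝ) ^ i • (2 ^ j : ℝ)⁻¹ • u) < ∞ := by
    intro i
    induction i with
    | zero => simpa using hj.trans_lt ENNReal.one_lt_top
    | succ i ih =>
      have := h _ ((hu.const_smul ((2 ^ j : ℝ)⁻¹)).const_smul ((2 : ℝ) ^ i)) ih
      rwa [smul_smul, ← pow_succ'] at this
  have := key j
  rwa [smul_smul, mul_inv_cancel₀ (by positivity), one_smul] at this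

theorem NFunction.Delta2Zero.hasFiniteModular [SigmaFinite μ] (h : G.Delta2Zero) :
    HasFiniteModular G μ := by
  obtain ⟨k, hk, h⟩ := h
  refine hasFiniteModular_of_modular_two_smul fun u _ hfin => ?_
  refine lt_of_le_of_lt ?_ (ENNReal.mul_lt_top (ENNReal.ofReal_lt_top (r := k)) hfin)
  rw [modular, modular, ← lintegral_const_mul' _ _ ENNReal.ofReal_ne_top]
  refine lintegral_mono fun x => ?_
  rw [← ENNReal.ofReal_mul hk.le, Pi.smul_apply, smul_eq_mul, abs_mul, abs_two]
  exact ENNReal.ofReal_le_ofReal (h _ (abs_nonneg _))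

theorem NFunction.Delta2.hasFiniteModular [IsFiniteMeasure μ] (h : G.Delta2) :
    HasFiniteModular G μ := by
  obtain ⟨k, hk, T, hT, h⟩ := h
  refine hasFiniteModular_of_modular_two_smul fun u hu hfin => ?_
  -- Below the threshold the growth is absorbed by a constant, integrable because the measure is
  -- finite.
  have hb : ∀ t, 0 ≤ t → G.eval (2 * t) ≤ k * G.eval t + G.eval (2 * T) := by
    intro t ht
    rcases le_total T t with hTt | hTt
    · linarith [h t hTt, G.eval_nonneg (by positivity : 0 ≤ 2 * T)]
    · have h1 := G.eval_mono (mem_Ici.2 (by positivity : 0 ≤ 2 * t))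
        (mem_Ici.2 (by positivity : 0 ≤ 2 * T)) (by linarith)
      linarith [mul_nonneg hk.le (G.eval_nonneg ht)]
  have hm : Measurable fun x => ENNReal.ofReal k * ENNReal.ofReal (G.eval |u x|) :=
    (G.measurable_eval_comp hu).ennreal_ofReal.const_mul _
  calc modular G μ ((2 : ℝ) • u)
      ≤ ∫⁻ x, (ENNReal.ofReal k * ENNReal.ofReal (G.eval |u x|) +
          ENNReal.ofReal (G.eval (2 * T))) ∂μ := by
        refine lintegral_mono fun x => ?_
        rw [← ENNReal.ofReal_mul hk.le, ← ENNReal.ofReal_add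
          (mul_nonneg hk.le (G.eval_nonneg (abs_nonneg _))) (G.eval_nonneg (by positivity)),
          Pi.smul_apply, smul_eq_mul, abs_mul, abs_two]
        exact ENNReal.ofReal_le_ofReal (hb _ (abs_nonneg _))
    _ = ENNReal.ofReal k * modular G μ u + ENNReal.ofReal (G.eval (2 * T)) * μ univ := by
        rw [lintegral_add_left hm, lintegral_const_mul' _ _ ENNReal.ofReal_ne_top,
          lintegral_const, modular]
    _ < ∞ := ENNReal.add_lt_top.2 ⟨ENNReal.mul_lt_top ENNReal.ofReal_lt_top hfin,
        ENNReal.mul_lt_top ENNReal.ofReal_lt_top (measure_lt_top μ univ)⟩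

end Orlicz

/-! ### The pairing, dominated convergence and set functions of functionals -/

section Orlicz

variable {α : Type*} [MeasurableSpace α] {G : NFunction} {μ : Measure α}

theorem orliczENorm_conj_conj (u : α → ℝ) : orliczENorm G.conj.conj μ u = orliczENorm G μ u := by
  have h : ∀ v : α → ℝ, modular G.conj.conj.conj μ v = modular G.conj μ v := modular_conj_conj
  simp only [orliczENorm, orliczClass, h]

/-- The measurable functions of finite Orlicz norm. -/
noncomputable def OrliczFun (G : NFunction) (μ : Measure α) : Submodule ℝ (α → ℝ) where
  carrier := {u | Measurable u ∧ orliczENorm G μ u < ∞}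
  zero_mem' := ⟨measurable_zero, by rw [orliczENorm_zero]; exact ENNReal.zero_lt_top⟩
  add_mem' hu hw := ⟨hu.1.add hw.1, (orliczENorm_add_le G hu.1.aestronglyMeasurable).trans_lt
    (ENNReal.add_lt_top.2 ⟨hu.2, hw.2⟩)⟩
  smul_mem' c u hu := ⟨hu.1.const_smul c, by
    rw [orliczENorm_smul]; exact ENNReal.mul_lt_top enorm_lt_top hu.2⟩

namespace OrliczFun

theorem mem_of_abs_le {u w : α → ℝ} (hu : Measurable u) (hw : w ∈ OrliczFun G μ)
    (h : ∀ x, |u x| ≤ |w x|) : u ∈ OrliczFun G μ :=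
  ⟨hu, (orliczENorm_mono (ae_of_all _ h)).trans_lt hw.2⟩

theorem mem_of_modular {u : α → ℝ} (hu : Measurable u) (h : modular G μ u < ∞) :
    u ∈ OrliczFun G μ :=
  ⟨hu, (orliczENorm_le_one_add_modular hu).trans_lt (ENNReal.add_lt_top.2 ⟨h, ENNReal.one_lt_top⟩)⟩

/-- The class of a function of finite Orlicz norm. -/
noncomputable def toSpace : OrliczFun G μ →ₗ[ℝ] OrliczSpace G μ where
  toFun u := ⟨AEEqFun.mk u.1 u.2.1.aestronglyMeasurable, by
    change orliczENorm G μ _ < ∞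
    rw [orliczENorm_congr G (AEEqFun.coeFn_mk _ _)]
    exact u.2.2⟩
  map_add' u w := Subtype.ext (AEEqFun.mk_add_mk _ _ _ _).symm
  map_smul' c u := Subtype.ext (AEEqFun.smul_mk _ _ _).symm

theorem coeFn_toSpace (u : OrliczFun G μ) :
    ((toSpace u : OrliczSpace G μ) : α →ₘ[μ] ℝ) =ᵐ[μ] (u : α → ℝ) :=
  AEEqFun.coeFn_mk _ _

theorem norm_toSpace (u : OrliczFun G μ) : ‖toSpace u‖ = (orliczENorm G μ (u : α → ℝ)).toReal := by
  rw [OrliczSpace.norm_def, orliczENorm_congr G (coeFn_toSpace u)]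

theorem norm_toSpace_le {u w : OrliczFun G μ} (h : ∀ x, |(u : α → ℝ) x| ≤ |(w : α → ℝ) x|) :
    ‖toSpace u‖ ≤ ‖toSpace w‖ := by
  rw [norm_toSpace, norm_toSpace]
  exact ENNReal.toReal_mono w.2.2.ne (orliczENorm_mono (ae_of_all _ h))

theorem exists_toSpace_eq (u : OrliczSpace G μ) : ∃ w : OrliczFun G μ, toSpace w = u :=
  ⟨⟨(u : α →ₘ[μ] ℝ), (u : α →ₘ[μ] ℝ).measurable, u.2⟩, Subtype.ext (AEEqFun.mk_coeFn _)⟩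

theorem toSpace_eq_of_ae {u w : OrliczFun G μ} (h : (u : α → ℝ) =ᵐ[μ] w) :
    toSpace u = toSpace w :=
  Subtype.ext (AEEqFun.mk_eq_mk.2 h)

end OrliczFun

open OrliczFun

theorem mul_mem_orliczFun {w f : α → ℝ} (hw : w ∈ OrliczFun G μ) (hf : Measurable f) {C : ℝ}
    (hC : ∀ x, |f x| ≤ C) : (fun x => f x * w x) ∈ OrliczFun G μ := by
  refine mem_of_abs_le (hf.mul hw.1) ((OrliczFun G μ).smul_mem C hw) fun x => ?_
  rw [Pi.smul_apply, smul_eq_mul, abs_mul, abs_mul]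
  exact mul_le_mul_of_nonneg_right ((hC x).trans (le_abs_self C)) (abs_nonneg _)

theorem indicator_mem_orliczFun {w : α → ℝ} (hw : w ∈ OrliczFun G μ) {s : Set α}
    (hs : MeasurableSet s) : s.indicator w ∈ OrliczFun G μ :=
  mem_of_abs_le (hw.1.indicator hs) hw fun x => by
    rw [indicator]; split_ifs <;> simp

theorem hasSum_indicator_of_pairwise_disjoint {ι β : Type*} {s : ι → Set β}
    (hd : Pairwise (Function.onFun Disjoint s)) (w : β → ℝ) (x : β) :
    HasSum (fun i => (s i).indicator w x) ((⋃ i, s i).indicator w x) := by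
  by_cases hx : x ∈ ⋃ i, s i
  · obtain ⟨k, hk⟩ := mem_iUnion.1 hx
    rw [indicator_of_mem hx, ← indicator_of_mem hk w]
    exact hasSum_single k fun i hi => indicator_of_notMem
      (fun hxi => disjoint_left.1 (hd hi) hxi hk) _
  · rw [indicator_of_notMem hx]
    have : ∀ i, (s i).indicator w x = 0 := fun i =>
      indicator_of_notMem (fun h => hx (mem_iUnion.2 ⟨i, h⟩)) _
    simp [this]

section SigmaFinite

variable [SigmaFinite μ]

theorem integrable_mul_of_mem {u v : α → ℝ} (hu : u ∈ OrliczFun G μ)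
    (hv : v ∈ OrliczFun G.conj μ) : Integrable (fun x => u x * v x) μ :=
  ⟨(hu.1.mul hv.1).aestronglyMeasurable,
    (lintegral_enorm_mul_le hv.1 hv.2).trans_lt (ENNReal.mul_lt_top hu.2 hv.2)⟩

theorem OrliczSpace.integrable_mul (u : OrliczSpace G μ) (v : OrliczSpace G.conj μ) :
    Integrable (fun x => (u : α →ₘ[μ] ℝ) x * (v : α →ₘ[μ] ℝ) x) μ :=
  integrable_mul_of_mem ⟨(u : α →ₘ[μ] ℝ).measurable, u.2⟩ ⟨(v : α →ₘ[μ] ℝ).measurable, v.2⟩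

/-- The pairing of an Orlicz space with that of the complementary N-function. -/
noncomputable def orliczPairing (G : NFunction) (μ : Measure α) [SigmaFinite μ] :
    OrliczSpace G.conj μ →L[ℝ] OrliczSpace G μ →L[ℝ] ℝ :=
  LinearMap.mkContinuous₂
    (LinearMap.mk₂ ℝ (fun (v : OrliczSpace G.conj μ) (u : OrliczSpace G μ) =>
        ∫ x, (u : α →ₘ[μ] ℝ) x * (v : α →ₘ[μ] ℝ) x ∂μ)
      (fun v w u => by
        rw [← integral_add (OrliczSpace.integrable_mul u v) (OrliczSpace.integrable_mul u w)]
        refine integral_congr_ae ?_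
        filter_upwards [AEEqFun.coeFn_add (v : α →ₘ[μ] ℝ) w] with x hx
        rw [Submodule.coe_add, hx, Pi.add_apply, mul_add])
      (fun c v u => by
        rw [smul_eq_mul, ← integral_const_mul]
        refine integral_congr_ae ?_
        filter_upwards [AEEqFun.coeFn_smul c (v : α →ₘ[μ] ℝ)] with x hx
        rw [Submodule.coe_smul, hx, Pi.smul_apply, smul_eq_mul, mul_left_comm])
      (fun v u w => by
        rw [← integral_add (OrliczSpace.integrable_mul u v) (OrliczSpace.integrable_mul w v)]
        refine integral_congr_ae ?_
        filter_upwards [AEEqFun.coeFn_add (u : α →ₘ[μ] ℝ) w] with x hx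
        rw [Submodule.coe_add, hx, Pi.add_apply, add_mul])
      (fun c v u => by
        rw [smul_eq_mul, ← integral_const_mul]
        refine integral_congr_ae ?_
        filter_upwards [AEEqFun.coeFn_smul c (u : α →ₘ[μ] ℝ)] with x hx
        rw [Submodule.coe_smul, hx, Pi.smul_apply, smul_eq_mul, mul_assoc])) 1
    (fun v u => by
      rw [LinearMap.mk₂_apply, one_mul, mul_comm]
      refine (norm_integral_le_integral_norm _).trans ?_
      rw [integral_norm_eq_lintegral_enorm (OrliczSpace.integrable_mul u v).1, OrliczSpace.norm_def,
        OrliczSpace.norm_def, ← ENNReal.toReal_mul]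
      exact ENNReal.toReal_mono (ENNReal.mul_lt_top u.2 v.2).ne
        (lintegral_enorm_mul_le (v : α →ₘ[μ] ℝ).measurable v.2))

theorem orliczPairing_apply (v : OrliczSpace G.conj μ) (u : OrliczSpace G μ) :
    orliczPairing G μ v u = ∫ x, (u : α →ₘ[μ] ℝ) x * (v : α →ₘ[μ] ℝ) x ∂μ := rfl

theorem orliczPairing_toSpace (v : OrliczFun G.conj μ) (u : OrliczFun G μ) :
    orliczPairing G μ (toSpace v) (toSpace u) = ∫ x, (u : α → ℝ) x * (v : α → ℝ) x ∂μ := by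
  rw [orliczPairing_apply]
  refine integral_congr_ae ?_
  filter_upwards [coeFn_toSpace u, coeFn_toSpace v] with x h1 h2
  rw [h1, h2]

/-- Dominated convergence in an Orlicz space. -/
theorem tendsto_toSpace (hP : HasFiniteModular G μ) {ι : Type*} {l : Filter ι}
    [l.IsCountablyGenerated] {f : ι → OrliczFun G μ} {g w : OrliczFun G μ}
    (hdom : ∀ i x, |(f i : α → ℝ) x| ≤ |(w : α → ℝ) x|)
    (hlim : ∀ x, Tendsto (fun i => (f i : α → ℝ) x) l (𝓝 ((g : α → ℝ) x))) :
    Tendsto (fun i => toSpace (f i)) l (𝓝 (toSpace g)) := by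
  rw [Metric.tendsto_nhds]
  intro ε hε
  set c : ℝ := 4 / ε with hc
  have hc0 : 0 < c := by positivity
  -- The dominating function: `hP` makes its modular finite, whatever the factor `c`.
  set b : α → ℝ := fun x => c * (|(w : α → ℝ) x| + |(g : α → ℝ) x|) with hb
  have hbmem : b ∈ OrliczFun G μ := by
    refine (OrliczFun G μ).smul_mem c ((OrliczFun G μ).add_mem ?_ ?_)
    · exact mem_of_abs_le w.2.1.norm w.2 fun x => (abs_abs _).le
    · exact mem_of_abs_le g.2.1.norm g.2 fun x => (abs_abs _).le
  have hdiff : ∀ i, Measurable (c • ((f i : α → ℝ) - (g : α → ℝ))) := fun i =>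
    ((f i).2.1.sub g.2.1).const_smul c
  have hmod : Tendsto (fun i => modular G μ (c • ((f i : α → ℝ) - (g : α → ℝ)))) l (𝓝 0) := by
    have h0 : ∫⁻ _ : α, (0 : ℝ≥0∞) ∂μ = 0 := lintegral_zero
    rw [← h0]
    refine tendsto_lintegral_filter_of_dominated_convergence
      (fun x => ENNReal.ofReal (G.eval |b x|))
      (Eventually.of_forall fun i => (G.measurable_eval_comp (hdiff i)).ennreal_ofReal)
      (Eventually.of_forall fun i => ae_of_all _ fun x => ?_) (hP b hbmem.1 hbmem.2).ne
      (ae_of_all _ fun x => ?_)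
    · refine ENNReal.ofReal_le_ofReal
        (G.eval_mono (mem_Ici.2 (abs_nonneg _)) (mem_Ici.2 (abs_nonneg _)) ?_)
      rw [Pi.smul_apply, smul_eq_mul, hb, abs_mul, abs_mul, Pi.sub_apply]
      refine mul_le_mul_of_nonneg_left ?_ (abs_nonneg c)
      refine (abs_sub _ _).trans ((add_le_add_left (hdom i x) _).trans (le_abs_self _))
    · have h1 : Tendsto (fun i => |(c • ((f i : α → ℝ) - (g : α → ℝ))) x|) l (𝓝 0) := by
        have h2 := (((hlim x).sub_const ((g : α → ℝ) x)).const_mul c).abs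
        simpa using h2
      have h3 : Tendsto (fun i => G.density 1 * |(c • ((f i : α → ℝ) - (g : α → ℝ))) x|) l (𝓝 0) := by
        simpa using h1.const_mul (G.density 1)
      have h4 : Tendsto (fun i => G.eval |(c • ((f i : α → ℝ) - (g : α → ℝ))) x|) l (𝓝 0) := by
        refine squeeze_zero' (Eventually.of_forall fun i => G.eval_nonneg (abs_nonneg _)) ?_ h3
        filter_upwards [h1.eventually (Iic_mem_nhds one_pos)] with i hi
        exact G.eval_le (abs_nonneg _) hi
      simpa using ENNReal.tendsto_ofReal h4
  filter_upwards [hmod.eventually (Iic_mem_nhds one_pos)] with i hi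
  have h1 : orliczENorm G μ (c • ((f i : α → ℝ) - (g : α → ℝ))) ≤ 2 := by
    refine (orliczENorm_le_one_add_modular (hdiff i)).trans ?_
    rw [← one_add_one_eq_two]
    exact add_le_add_left hi 1
  rw [dist_eq_norm, ← map_sub]
  have h2 : c * ‖toSpace (f i - g)‖ ≤ 2 := by
    have h3 := ENNReal.toReal_mono (by simp) h1
    rw [orliczENorm_smul, ENNReal.toReal_mul, toReal_enorm, Real.norm_of_nonneg hc0.le] at h3
    rw [norm_toSpace]
    simpa using h3
  rw [hc, div_mul_eq_mul_div, div_le_iff₀ hε] at h2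
  linarith

/-- The constant `1` need not belong to the space when the measure is infinite; a strictly positive
weight replaces it, and one can divide by it. Cutting at `1` makes the modular comparable to the
`L¹` norm. -/
theorem exists_pos_mem_orliczFun (G : NFunction) (μ : Measure α) [SigmaFinite μ] :
    ∃ w ∈ OrliczFun G μ, ∀ x, 0 < w x := by
  obtain ⟨g, hg0, hgm, hg⟩ := exists_pos_lintegral_lt_of_sigmaFinite μ one_ne_zero
  refine ⟨fun x => min (g x : ℝ) 1, mem_of_modular (hgm.coe_nnreal_real.min measurable_const) ?_,
    fun x => lt_min (hg0 x) one_pos⟩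
  calc modular G μ (fun x => min (g x : ℝ) 1)
      ≤ ∫⁻ x, ENNReal.ofReal (G.density 1) * (g x : ℝ≥0∞) ∂μ := by
        refine lintegral_mono fun x => ?_
        have h0 : 0 ≤ min (g x : ℝ) 1 := le_min (g x).2 zero_le_one
        rw [abs_of_nonneg h0, ← ENNReal.ofReal_coe_nnreal,
          ← ENNReal.ofReal_mul (G.density_nonneg zero_le_one)]
        refine ENNReal.ofReal_le_ofReal ((G.eval_le h0 (min_le_right _ _)).trans ?_)
        exact mul_le_mul_of_nonneg_left (min_le_left _ _) (G.density_nonneg zero_le_one)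
    _ = ENNReal.ofReal (G.density 1) * ∫⁻ x, (g x : ℝ≥0∞) ∂μ :=
        lintegral_const_mul' _ _ ENNReal.ofReal_ne_top
    _ < ∞ := ENNReal.mul_lt_top ENNReal.ofReal_lt_top (hg.trans ENNReal.one_lt_top)

/-- The signed measure `A ↦ F(w 1_A)` attached to a functional `F` and a weight `w`. -/
theorem exists_signedMeasure_of_functional (hP : HasFiniteModular G μ)
    (F : OrliczSpace G μ →L[ℝ] ℝ) (w : OrliczFun G μ) :
    ∃ ν : SignedMeasure α, ∀ (s : Set α) (hs : MeasurableSet s),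
      ν s = F (toSpace ⟨s.indicator w, indicator_mem_orliczFun w.2 hs⟩) := by
  classical
  refine ⟨{ measureOf' := fun s => if hs : MeasurableSet s then
              F (toSpace ⟨s.indicator w, indicator_mem_orliczFun w.2 hs⟩) else 0
            empty' := ?_
            not_measurable' := fun s hs => dif_neg hs
            m_iUnion' := ?_ }, fun s hs => dif_pos hs⟩
  · have h0 : (⟨(∅ : Set α).indicator w, indicator_mem_orliczFun w.2 MeasurableSet.empty⟩ :
        OrliczFun G μ) = 0 := Subtype.ext (indicator_empty _)
    rw [dif_pos MeasurableSet.empty, h0, map_zero, map_zero]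
  · intro s hs hd
    simp only [dif_pos (MeasurableSet.iUnion hs), dif_pos (hs _)]
    refine F.hasSum (f := fun i => toSpace (⟨(s i).indicator w,
      indicator_mem_orliczFun w.2 (hs i)⟩ : OrliczFun G μ)) ?_
    have hcoe : ∀ (t : Finset ℕ) (x : α),
        ((∑ i ∈ t, (⟨(s i).indicator w, indicator_mem_orliczFun w.2 (hs i)⟩ : OrliczFun G μ) :
          OrliczFun G μ) : α → ℝ) x = ∑ i ∈ t, (s i).indicator (w : α → ℝ) x := by
      intro t x
      rw [AddSubmonoidClass.coe_finsetSum, Finset.sum_apply]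
    -- Countable additivity: the finite partial sums are indicators times `w`, so `w` itself
    -- dominates them.
    have h := tendsto_toSpace hP (l := atTop)
      (f := fun t : Finset ℕ => ∑ i ∈ t,
        (⟨(s i).indicator w, indicator_mem_orliczFun w.2 (hs i)⟩ : OrliczFun G μ))
      (g := ⟨(⋃ i, s i).indicator w, indicator_mem_orliczFun w.2 (MeasurableSet.iUnion hs)⟩)
      (w := w) (fun t x => ?_) (fun x => ?_)
    · simpa only [HasSum, map_sum, SummationFilter.unconditional_filter] using h
    · rw [hcoe]
      have e : ∑ i ∈ t, (s i).indicator (w : α → ℝ) x =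
          (⋃ i ∈ t, s i).indicator (w : α → ℝ) x := by
        rw [Finset.indicator_biUnion_apply t s (fun i _ j _ hij => hd hij)]
      rw [e, indicator]
      split_ifs <;> simp
    · simp only [hcoe]
      exact hasSum_indicator_of_pairwise_disjoint hd w x

end SigmaFinite

end Orlicz

/-! ### Integral representation of functionals and sufficiency -/

section Orlicz

variable {α : Type*} [MeasurableSpace α] {G : NFunction} {μ : Measure α}

open OrliczFun

/-- The sign of a real function, with values `1` and `-1`, as a simple function. -/
noncomputable def signSimple {h : α → ℝ} (hh : Measurable h) : SimpleFunc α ℝ :=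
  SimpleFunc.piecewise {x | 0 ≤ h x} (measurableSet_le measurable_const hh)
    (SimpleFunc.const α 1) (SimpleFunc.const α (-1))

theorem signSimple_mul_self {h : α → ℝ} (hh : Measurable h) (x : α) :
    signSimple hh x * h x = |h x| := by
  rw [signSimple, SimpleFunc.piecewise_apply]
  split_ifs with hx
  · simp [abs_of_nonneg (show 0 ≤ h x from hx)]
  · simp [abs_of_neg (lt_of_not_ge (show ¬ 0 ≤ h x from hx))]

theorem abs_signSimple {h : α → ℝ} (hh : Measurable h) (x : α) : |signSimple hh x| = 1 := by
  rw [signSimple, SimpleFunc.piecewise_apply]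
  split_ifs <;> simp

theorem exists_abs_simpleFunc_le (f : SimpleFunc α ℝ) : ∃ C, ∀ x, |f x| ≤ C :=
  f.exists_forall_norm_le

theorem simpleFunc_mul_mem (f : SimpleFunc α ℝ) (w : OrliczFun G μ) :
    (fun x => f x * (w : α → ℝ) x) ∈ OrliczFun G μ := by
  obtain ⟨C, hC⟩ := exists_abs_simpleFunc_le f
  exact mul_mem_orliczFun w.2 f.measurable hC

theorem integrable_simpleFunc_mul (f : SimpleFunc α ℝ) {h : α → ℝ} (hh : Integrable h μ) :
    Integrable (fun x => f x * h x) μ := by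
  obtain ⟨C, hC⟩ := exists_abs_simpleFunc_le f
  exact hh.bdd_mul f.aestronglyMeasurable (ae_of_all _ hC)

section SigmaFinite

variable [SigmaFinite μ]

/-- On a null set `w 1_A` has class zero, so the signed measure is absolutely continuous and
Radon–Nikodym applies; linearity passes from indicators to simple functions. -/
theorem exists_density_of_functional (hP : HasFiniteModular G μ)
    (F : OrliczSpace G μ →L[ℝ] ℝ) (w : OrliczFun G μ) :
    ∃ h : α → ℝ, Measurable h ∧ Integrable h μ ∧ ∀ f : SimpleFunc α ℝ,
      F (toSpace ⟨fun x => f x * (w : α → ℝ) x, simpleFunc_mul_mem f w⟩) =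
        ∫ x, f x * h x ∂μ := by
  obtain ⟨ν, hν⟩ := exists_signedMeasure_of_functional hP F w
  have hac : VectorMeasure.AbsolutelyContinuous ν μ.toENNRealVectorMeasure := by
    refine VectorMeasure.AbsolutelyContinuous.mk fun s hs h0 => ?_
    rw [Measure.toENNRealVectorMeasure_apply_measurable hs] at h0
    have e : toSpace ⟨s.indicator w, indicator_mem_orliczFun w.2 hs⟩ =
        toSpace (0 : OrliczFun G μ) := toSpace_eq_of_ae (indicator_meas_zero h0)
    rw [hν s hs, e, map_zero, map_zero]
  have hint := SignedMeasure.integrable_rnDeriv ν μ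
  refine ⟨ν.rnDeriv μ, SignedMeasure.measurable_rnDeriv ν μ, hint, fun f => ?_⟩
  induction f using SimpleFunc.induction with
  | const c hs =>
    rename_i s
    have h1 := hν s hs
    rw [← SignedMeasure.withDensityᵥ_rnDeriv_eq ν μ hac, withDensityᵥ_apply hint hs] at h1
    have h2 : (⟨_, simpleFunc_mul_mem (SimpleFunc.piecewise s hs (SimpleFunc.const α c)
        (SimpleFunc.const α 0)) w⟩ : OrliczFun G μ) =
        c • ⟨s.indicator w, indicator_mem_orliczFun w.2 hs⟩ := by
      refine Subtype.ext (funext fun x => ?_)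
      by_cases hx : x ∈ s <;> simp [hx]
    rw [h2, map_smul, map_smul, ← h1, smul_eq_mul, ← integral_const_mul, ← integral_indicator hs]
    refine integral_congr_ae (ae_of_all _ fun x => ?_)
    by_cases hx : x ∈ s <;> simp [hx]
  | add hd hf hg =>
    rename_i f g
    have h2 : (⟨_, simpleFunc_mul_mem (f + g) w⟩ : OrliczFun G μ) =
        ⟨_, simpleFunc_mul_mem f w⟩ + ⟨_, simpleFunc_mul_mem g w⟩ :=
      Subtype.ext (funext fun x => add_mul (f x) (g x) _)
    rw [h2, map_add, map_add, hf, hg, ← integral_add (integrable_simpleFunc_mul f hint)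
      (integrable_simpleFunc_mul g hint)]
    exact integral_congr_ae (ae_of_all _ fun x => (add_mul (f x) (g x) _).symm)

/-- Under finiteness of the modular every functional is given by integration. -/
theorem exists_representation (hP : HasFiniteModular G μ) (F : OrliczSpace G μ →L[ℝ] ℝ) :
    ∃ v : α → ℝ, Measurable v ∧ ∀ u : OrliczFun G μ,
      Integrable (fun x => (u : α → ℝ) x * v x) μ ∧
        F (toSpace u) = ∫ x, (u : α → ℝ) x * v x ∂μ := by
  obtain ⟨w, hw, hw0⟩ := exists_pos_mem_orliczFun G μ
  obtain ⟨h, hm, hint, hF⟩ := exists_density_of_functional hP F ⟨w, hw⟩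
  refine ⟨fun x => h x / w x, hm.div hw.1, fun u => ?_⟩
  -- With `v = h / w` and `u = q w`, the claim becomes the identity for `q` against `h`, known for
  -- simple `q`.
  set q : α → ℝ := fun x => (u : α → ℝ) x / w x with hq
  have hqm : Measurable q := u.2.1.div hw.1
  have hqw : ∀ x, q x * w x = (u : α → ℝ) x := fun x => div_mul_cancel₀ _ (hw0 x).ne'
  have huv : ∀ x, (u : α → ℝ) x * (h x / w x) = q x * h x := fun x => by
    rw [hq]; ring
  simp only [huv]
  set s : ℕ → SimpleFunc α ℝ := fun n => SimpleFunc.approxOn q hqm univ 0 (mem_univ 0) n with hs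
  have hsb : ∀ n x, |s n x| ≤ 2 * |q x| := fun n x => by
    rw [two_mul]; exact SimpleFunc.norm_approxOn_zero_le hqm (mem_univ 0) x n
  have hslim : ∀ x, Tendsto (fun n => s n x) atTop (𝓝 (q x)) := fun x =>
    SimpleFunc.tendsto_approxOn hqm (mem_univ 0) (by simp)
  have hdom : ∀ n x, |s n x * w x| ≤ |((2 : ℝ) • (u : α → ℝ)) x| := fun n x => by
    rw [Pi.smul_apply, smul_eq_mul, ← hqw x, abs_mul, abs_mul, abs_mul, abs_two, ← mul_assoc]
    exact mul_le_mul_of_nonneg_right (hsb n x) (abs_nonneg _)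
  -- Testing `F` on `|s n| sign(h) w`, which `2u` dominates, bounds these integrals uniformly;
  -- Fatou's lemma then makes `q h` integrable.
  have hbound : ∀ n, ∫⁻ x, ‖s n x * h x‖ₑ ∂μ ≤
      ENNReal.ofReal (‖F‖ * ‖toSpace ((2 : ℝ) • u)‖) := by
    intro n
    have hn := hF (((s n).map fun t => |t|) * signSimple hm)
    have habs : ∀ x, (((s n).map fun t => |t|) * signSimple hm) x * h x = ‖s n x * h x‖ := by
      intro x
      rw [SimpleFunc.mul_apply, mul_assoc, signSimple_mul_self, SimpleFunc.map_apply,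
        Real.norm_eq_abs, abs_mul]
    simp only [habs] at hn
    rw [← ofReal_integral_norm_eq_lintegral_enorm (integrable_simpleFunc_mul (s n) hint), ← hn]
    refine ENNReal.ofReal_le_ofReal ((Real.le_norm_self _).trans ((F.le_opNorm _).trans ?_))
    refine mul_le_mul_of_nonneg_left (norm_toSpace_le fun x => ?_) (norm_nonneg _)
    refine le_trans (le_of_eq ?_) (hdom n x)
    change |((s n).map (fun t => |t|) * signSimple hm) x * w x| = _
    rw [SimpleFunc.mul_apply, SimpleFunc.map_apply, abs_mul, abs_mul, abs_mul, abs_abs,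
      abs_signSimple, mul_one]
  have hqint : Integrable (fun x => q x * h x) μ := by
    refine ⟨(hqm.mul hm).aestronglyMeasurable, ?_⟩
    have hlim : ∀ x, Tendsto (fun n => ‖s n x * h x‖ₑ) atTop (𝓝 ‖q x * h x‖ₑ) := fun x =>
      ((hslim x).mul_const (h x)).enorm
    calc ∫⁻ x, ‖q x * h x‖ₑ ∂μ = ∫⁻ x, liminf (fun n => ‖s n x * h x‖ₑ) atTop ∂μ :=
          lintegral_congr fun x => (hlim x).liminf_eq.symm
      _ ≤ liminf (fun n => ∫⁻ x, ‖s n x * h x‖ₑ ∂μ) atTop :=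
          lintegral_liminf_le fun n => ((s n).measurable.mul hm).enorm
      _ ≤ ENNReal.ofReal (‖F‖ * ‖toSpace ((2 : ℝ) • u)‖) :=
          liminf_le_of_le (by isBoundedDefault) fun b hb => by
            obtain ⟨n, hn⟩ := hb.exists
            exact hn.trans (hbound n)
      _ < ∞ := ENNReal.ofReal_lt_top
  refine ⟨hqint, ?_⟩
  have hL : Tendsto (fun n => F (toSpace ⟨_, simpleFunc_mul_mem (s n) ⟨w, hw⟩⟩)) atTop
      (𝓝 (F (toSpace u))) := by
    refine (F.continuous.tendsto _).comp (tendsto_toSpace hP (w := (2 : ℝ) • u) hdom fun x => ?_)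
    have := (hslim x).mul_const (w x)
    rwa [hqw x] at this
  have hR : Tendsto (fun n => ∫ x, s n x * h x ∂μ) atTop (𝓝 (∫ x, q x * h x ∂μ)) := by
    refine tendsto_integral_of_dominated_convergence (fun x => 2 * ‖q x * h x‖)
      (fun n => ((s n).measurable.mul hm).aestronglyMeasurable) (hqint.norm.const_mul 2)
      (fun n => ae_of_all _ fun x => ?_) (ae_of_all _ fun x => (hslim x).mul_const _)
    rw [norm_mul, norm_mul, ← mul_assoc]
    exact mul_le_mul_of_nonneg_right (hsb n x) (norm_nonneg _)
  simp only [hF] at hL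
  exact tendsto_nhds_unique hL hR

/-- A function representing a functional has finite complementary norm. -/
theorem orliczENorm_conj_le_of_representation {v : α → ℝ} (hv : Measurable v)
    {F : OrliczSpace G μ →L[ℝ] ℝ}
    (h : ∀ u : OrliczFun G μ, Integrable (fun x => (u : α → ℝ) x * v x) μ ∧
      F (toSpace u) = ∫ x, (u : α → ℝ) x * v x ∂μ) :
    orliczENorm G.conj μ v ≤ ENNReal.ofReal (2 * ‖F‖) := by
  refine iSup₂_le fun u hu => ?_
  have hmod : modular G μ u ≤ 1 := by rw [← modular_conj_conj]; exact hu.2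
  -- The source of the factor 2: admissibility is a modular bound, which controls the norm only up
  -- to `1 + 1`.
  have hnorm : orliczENorm G μ u ≤ 2 := by
    refine (orliczENorm_le_one_add_modular hu.1.1).trans ?_
    rw [← one_add_one_eq_two]
    gcongr
  have humem : u ∈ OrliczFun G μ := ⟨hu.1.1, hnorm.trans_lt (by simp)⟩
  have hsmem : (fun x => |u x| * signSimple hv x) ∈ OrliczFun G μ :=
    mem_of_abs_le (hu.1.1.norm.mul (signSimple hv).measurable) humem fun x => by
      rw [abs_mul, abs_signSimple, abs_abs, mul_one]
  have habs : ∀ x, |u x| * signSimple hv x * v x = ‖v x * u x‖ := fun x => by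
    rw [mul_assoc, signSimple_mul_self, norm_mul, mul_comm]; rfl
  obtain ⟨h1, h2⟩ := h ⟨_, hsmem⟩
  have h3 : Integrable (fun x => v x * u x) μ := by
    simpa only [mul_comm] using (h ⟨u, humem⟩).1
  simp only [habs] at h2
  rw [← ofReal_integral_norm_eq_lintegral_enorm h3, ← h2]
  refine ENNReal.ofReal_le_ofReal ((Real.le_norm_self _).trans ((F.le_opNorm _).trans ?_))
  rw [mul_comm]
  refine mul_le_mul_of_nonneg_right ?_ (norm_nonneg _)
  refine (norm_toSpace_le (w := ⟨u, humem⟩) fun x => ?_).trans ?_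
  · change |(|u x| * signSimple hv x)| ≤ |u x|
    rw [abs_mul, abs_signSimple, abs_abs, mul_one]
  · rw [norm_toSpace]
    simpa using ENNReal.toReal_mono (by simp) hnorm

/-- Composed with the pairing, `Φ` becomes a functional on `L^{G*}`, hence integration against some
`u` in `L^{G**} = L^G`. Every functional on `L^G` comes from the pairing, so `Φ` is evaluation at
`u`. -/
theorem isReflexiveSpace_of_hasFiniteModular (h1 : HasFiniteModular G μ)
    (h2 : HasFiniteModular G.conj μ) : IsReflexiveSpace (OrliczSpace G μ) := by
  intro Φ
  set F : OrliczSpace G.conj μ →L[ℝ] ℝ := Φ.comp (orliczPairing G μ) with hFdef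
  obtain ⟨u, hu, hF⟩ := exists_representation h2 F
  have humem : u ∈ OrliczFun G μ := ⟨hu, by
    rw [← orliczENorm_conj_conj]
    exact (orliczENorm_conj_le_of_representation hu hF).trans_lt ENNReal.ofReal_lt_top⟩
  refine ⟨toSpace ⟨u, humem⟩, ContinuousLinearMap.ext fun f => ?_⟩
  obtain ⟨v, hv, hf⟩ := exists_representation h1 f
  have hvmem : v ∈ OrliczFun G.conj μ :=
    ⟨hv, (orliczENorm_conj_le_of_representation hv hf).trans_lt ENNReal.ofReal_lt_top⟩
  have e : orliczPairing G μ (toSpace ⟨v, hvmem⟩) = f := by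
    refine ContinuousLinearMap.ext fun y => ?_
    obtain ⟨y, rfl⟩ := exists_toSpace_eq y
    rw [orliczPairing_toSpace, (hf y).2]
  rw [NormedSpace.dual_def, (hf ⟨u, humem⟩).2]
  have h3 := (hF ⟨v, hvmem⟩).2
  rw [hFdef, ContinuousLinearMap.comp_apply, e] at h3
  rw [h3]
  exact integral_congr_ae (ae_of_all _ fun x => mul_comm _ _)

end SigmaFinite

end Orlicz

/-- A point at positive distance from a subspace is separated from it by a functional. -/
theorem exists_functional_vanishing_on {X : Type*} [NormedAddCommGroup X] [NormedSpace ℝ X]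
    (E : Submodule ℝ X) {x : X} {ε : ℝ} (hε : 0 < ε) (h : ∀ y ∈ E, ε ≤ ‖x - y‖) :
    ∃ f : X →L[ℝ] ℝ, (∀ y ∈ E, f y = 0) ∧ f x ≠ 0 := by
  have hx : x ∉ closure (E : Set X) := fun hx => by
    obtain ⟨y, hy, hxy⟩ := Metric.mem_closure_iff.1 hx ε hε
    rw [dist_eq_norm] at hxy
    exact absurd (h y hy) (not_le.2 hxy)
  obtain ⟨f, s, hf, hs⟩ := geometric_hahn_banach_closed_point E.convex.closure isClosed_closure hx
  have hE : ∀ y ∈ E, f y = 0 := fun y hy => by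
    by_contra hne
    -- A functional bounded above on a subspace vanishes there: otherwise a multiple of `y` would
    -- attain the bound `s`.
    have h1 := hf ((s / f y) • y) (subset_closure (E.smul_mem _ hy))
    rw [map_smul, smul_eq_mul, div_mul_cancel₀ _ hne] at h1
    exact lt_irrefl _ h1
  have h0 := hf 0 (subset_closure E.zero_mem)
  rw [map_zero] at h0
  exact ⟨f, hE, (h0.trans hs).ne'⟩

/-! ### The heart of the Orlicz space and necessity -/

section Orlicz

variable {α : Type*} [MeasurableSpace α] {G : NFunction} {μ : Measure α}

open OrliczFun

/-- The subspace of the elements all of whose multiples have finite modular. -/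
noncomputable def orliczHeart (G : NFunction) (μ : Measure α) : Submodule ℝ (OrliczSpace G μ) where
  carrier := {u | ∀ c : ℝ, modular G μ (c • ((u : α →ₘ[μ] ℝ) : α → ℝ)) < ∞}
  zero_mem' := fun c => by
    have h : c • (((0 : OrliczSpace G μ) : α →ₘ[μ] ℝ) : α → ℝ) =ᵐ[μ] 0 := by
      filter_upwards [AEEqFun.coeFn_zero (α := α) (μ := μ) (β := ℝ)] with x hx
      rw [Pi.smul_apply, Submodule.coe_zero, hx]
      simp
    rw [modular_congr h]
    simp [modular, G.eval_zero]
  add_mem' := fun {u w} hu hw c => by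
    have h : c • (((u + w : OrliczSpace G μ) : α →ₘ[μ] ℝ) : α → ℝ) =ᵐ[μ]
        c • ((u : α →ₘ[μ] ℝ) : α → ℝ) + c • ((w : α →ₘ[μ] ℝ) : α → ℝ) := by
      filter_upwards [AEEqFun.coeFn_add (u : α →ₘ[μ] ℝ) w] with x hx
      rw [Pi.smul_apply, Submodule.coe_add, hx, ← smul_add, Pi.smul_apply]
    rw [modular_congr h]
    refine (modular_add_le ((u : α →ₘ[μ] ℝ).measurable.const_smul c)).trans_lt
      (ENNReal.add_lt_top.2 ⟨?_, ?_⟩)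
    · rw [smul_smul]; exact hu _
    · rw [smul_smul]; exact hw _
  smul_mem' := fun a u hu c => by
    have h : c • (((a • u : OrliczSpace G μ) : α →ₘ[μ] ℝ) : α → ℝ) =ᵐ[μ]
        (c * a) • ((u : α →ₘ[μ] ℝ) : α → ℝ) := by
      filter_upwards [AEEqFun.coeFn_smul a (u : α →ₘ[μ] ℝ)] with x hx
      rw [Pi.smul_apply, Submodule.coe_smul, hx, Pi.smul_apply, Pi.smul_apply, smul_smul]
    rw [modular_congr h]
    exact hu _

theorem toSpace_mem_orliczHeart {u : OrliczFun G μ}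
    (h : ∀ c : ℝ, modular G μ (c • (u : α → ℝ)) < ∞) : toSpace u ∈ orliczHeart G μ := fun c => by
  rw [modular_congr ((coeFn_toSpace u).const_smul c)]
  exact h c

theorem modular_smul_indicator_lt_top {s : Set α} (hs : MeasurableSet s) (hμs : μ s < ∞) (c : ℝ) :
    modular G μ (c • s.indicator (1 : α → ℝ)) < ∞ := by
  refine modular_lt_top_of_bounded hs hμs (M := |c|) (fun x => ?_) fun x hx => ?_
  · by_cases hx : x ∈ s <;> simp [hx]
  · simp [hx]

theorem indicator_one_mem_orliczFun {s : Set α} (hs : MeasurableSet s) (hμs : μ s < ∞) :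
    s.indicator (1 : α → ℝ) ∈ OrliczFun G μ :=
  mem_of_modular (measurable_one.indicator hs) (by
    simpa using modular_smul_indicator_lt_top (G := G) hs hμs 1)

section SigmaFinite

variable [SigmaFinite μ]

/-- The elements of infinite modular are far from those all of whose multiples have finite
modular. -/
theorem half_le_norm_sub {u : OrliczFun G μ} (hu : modular G μ (u : α → ℝ) = ∞)
    {y : OrliczSpace G μ} (hy : y ∈ orliczHeart G μ) : 1 / 2 ≤ ‖toSpace u - y‖ := by
  by_contra! hlt
  obtain ⟨w, rfl⟩ := exists_toSpace_eq y
  rw [← map_sub, norm_toSpace] at hlt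
  -- If the distance were below 1/2, then `2(u - w)` would have modular at most 1, and `ρ(u) ≤ ρ(2(u
  -- - w)) + ρ(2w)` would be finite.
  have h1 : orliczENorm G μ ((2 : ℝ) • ((u : α → ℝ) - (w : α → ℝ))) ≤ 1 := by
    have := orliczENorm_inv_smul_le (G := G) (μ := μ) (u := (u : α → ℝ) - (w : α → ℝ))
      one_half_pos ((ENNReal.le_ofReal_iff_toReal_le (u - w).2.2.ne (by norm_num)).2 hlt.le)
    simpa using this
  have h2 := modular_le_one ((u.2.1.sub w.2.1).const_smul (2 : ℝ)) h1
  have h3 : modular G μ ((2 : ℝ) • (w : α → ℝ)) < ∞ := by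
    rw [← modular_congr ((coeFn_toSpace w).const_smul (2 : ℝ))]
    exact hy 2
  have h4 := modular_add_le (G := G) (μ := μ) (w := (w : α → ℝ)) (u.2.1.sub w.2.1)
  rw [sub_add_cancel, hu] at h4
  exact absurd (h4.trans_lt (ENNReal.add_lt_top.2 ⟨h2.trans_lt ENNReal.one_lt_top, h3⟩))
    (lt_irrefl _)

/-- An element is determined by its integrals over the sets of finite measure. -/
theorem ae_eq_of_orliczPairing_indicator {u w : OrliczFun G μ}
    (h : ∀ (s : Set α) (hs : MeasurableSet s) (hμs : μ s < ∞),
      orliczPairing G μ (toSpace ⟨_, indicator_one_mem_orliczFun hs hμs⟩) (toSpace u) =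
        orliczPairing G μ (toSpace ⟨_, indicator_one_mem_orliczFun hs hμs⟩) (toSpace w)) :
    toSpace u = toSpace w := by
  have key : ∀ (f : OrliczFun G μ) (s : Set α) (hs : MeasurableSet s) (hμs : μ s < ∞),
      IntegrableOn (f : α → ℝ) s μ ∧
      orliczPairing G μ (toSpace ⟨_, indicator_one_mem_orliczFun hs hμs⟩) (toSpace f) =
        ∫ x in s, (f : α → ℝ) x ∂μ := by
    intro f s hs hμs
    have e : (fun x => (f : α → ℝ) x * s.indicator (1 : α → ℝ) x) = s.indicator (f : α → ℝ) := by
      funext x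
      by_cases hx : x ∈ s <;> simp [hx]
    have hi := integrable_mul_of_mem f.2 (indicator_one_mem_orliczFun (G := G.conj) hs hμs)
    rw [e] at hi
    refine ⟨(integrable_indicator_iff hs).1 hi, ?_⟩
    rw [orliczPairing_toSpace, ← integral_indicator hs, ← e]
  refine toSpace_eq_of_ae (ae_eq_of_forall_setIntegral_eq_of_sigmaFinite
    (fun s hs hμs => (key u s hs hμs).1) (fun s hs hμs => (key w s hs hμs).1)
    fun s hs hμs => ?_)
  rw [← (key u s hs hμs).2, ← (key w s hs hμs).2, h s hs hμs]

theorem truncation_mem_orliczFun (u : OrliczFun G μ) (n : ℕ) :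
    truncation μ (u : α → ℝ) n ∈ OrliczFun G μ :=
  mem_of_abs_le (measurable_truncation u.2.1 n) u.2 (abs_truncation_le _ n)

theorem tendsto_orliczPairing_truncation (u : OrliczFun G μ) (v : OrliczFun G.conj μ) :
    Tendsto (fun n => orliczPairing G μ (toSpace v) (toSpace ⟨_, truncation_mem_orliczFun u n⟩))
      atTop (𝓝 (orliczPairing G μ (toSpace v) (toSpace u))) := by
  simp only [orliczPairing_toSpace]
  refine tendsto_integral_of_dominated_convergence
    (fun x => ‖(u : α → ℝ) x * (v : α → ℝ) x‖)
    (fun n => ((measurable_truncation u.2.1 n).mul v.2.1).aestronglyMeasurable)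
    (integrable_mul_of_mem u.2 v.2).norm (fun n => ae_of_all _ fun x => ?_)
    (ae_of_all _ fun x => ?_)
  · rw [norm_mul, norm_mul]
    exact mul_le_mul_of_nonneg_right (abs_truncation_le _ n x) (norm_nonneg _)
  · exact tendsto_const_nhds.congr'
      ((truncation_eventuallyEq (μ := μ) (u : α → ℝ) x).mono fun n hn => by simp only [hn])

/-- In a reflexive space every bounded sequence has a weak limit along some ultrafilter. -/
theorem IsReflexiveSpace.exists_weak_limit {X : Type*} [NormedAddCommGroup X] [NormedSpace ℝ X]
    (h : IsReflexiveSpace X) {x : ℕ → X} {C : ℝ} (hC : ∀ n, ‖x n‖ ≤ C) :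
    ∃ y : X, ∀ f : X →L[ℝ] ℝ,
      Tendsto (fun n => f (x n)) (hyperfilter ℕ : Filter ℕ) (𝓝 (f y)) := by
  -- Banach–Alaoglu in the bidual. An ultrafilter replaces subsequences, as weak-* compactness need
  -- not be sequential.
  have hK := WeakDual.isCompact_closedBall (𝕜 := ℝ) (E := X →L[ℝ] ℝ) 0 C
  obtain ⟨Ψ, -, hΨ⟩ := hK.ultrafilter_le_nhds ((hyperfilter ℕ).map fun n =>
      StrongDual.toWeakDual (NormedSpace.inclusionInDoubleDual ℝ X (x n))) (by
    rw [le_principal_iff]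
    refine mem_map.2 (univ_mem' fun n => ?_)
    rw [mem_preimage, mem_preimage, mem_closedBall_zero_iff]
    exact (NormedSpace.double_dual_bound ℝ X (x n)).trans (hC n))
  obtain ⟨y, hy⟩ := h (WeakDual.toStrongDual Ψ)
  refine ⟨y, fun f => ?_⟩
  have h1 : Tendsto (fun n => StrongDual.toWeakDual (NormedSpace.inclusionInDoubleDual ℝ X (x n)))
      (hyperfilter ℕ : Filter ℕ) (𝓝 Ψ) := hΨ
  have h2 := ((WeakDual.eval_continuous f).tendsto Ψ).comp h1
  have h3 : Ψ f = f y := by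
    rw [← NormedSpace.dual_def ℝ X y f, hy]; rfl
  rw [h3] at h2
  exact h2

/-- The truncations of `u` are bounded, and integration over sets of finite measure identifies their
weak limit as `u`. A functional vanishing on the heart vanishes on the truncations, hence at `u`. -/
theorem IsReflexiveSpace.hasFiniteModular (h : IsReflexiveSpace (OrliczSpace G μ)) :
    HasFiniteModular G μ := by
  intro u hu hfin
  by_contra hinf
  have hinf : modular G μ u = ∞ := not_lt_top_iff.1 hinf
  set U : OrliczFun G μ := ⟨u, hu, hfin⟩ with hU
  obtain ⟨Φ, hΦ, hne⟩ := exists_functional_vanishing_on (orliczHeart G μ) one_half_pos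
    (fun y hy => half_le_norm_sub (u := U) hinf hy)
  obtain ⟨y, hy⟩ := h.exists_weak_limit
    (x := fun n => toSpace ⟨_, truncation_mem_orliczFun U n⟩) (C := ‖toSpace U‖)
    (fun n => norm_toSpace_le (abs_truncation_le _ n))
  obtain ⟨w, rfl⟩ := exists_toSpace_eq y
  have hle : (hyperfilter ℕ : Filter ℕ) ≤ atTop := Nat.hyperfilter_le_atTop
  have hw : toSpace w = toSpace U := ae_eq_of_orliczPairing_indicator fun s hs hμs =>
    tendsto_nhds_unique (hy _) ((tendsto_orliczPairing_truncation U _).mono_left hle)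
  have h0 : ∀ n, Φ (toSpace ⟨_, truncation_mem_orliczFun U n⟩) = 0 := fun n =>
    hΦ _ (toSpace_mem_orliczHeart fun c => modular_smul_truncation_lt_top c _ n)
  have hlim := hy Φ
  simp only [h0] at hlim
  rw [hw] at hlim
  exact hne (tendsto_nhds_unique hlim tendsto_const_nhds)

/-- The pairing embeds `L^{G*}` in the dual of `L^G` with norm bounded below, so the distance 1/2
from the heart remains at least 1/4 in the dual. -/
theorem norm_le_two_mul_norm_orliczPairing (y : OrliczSpace G.conj μ) :
    ‖y‖ ≤ 2 * ‖orliczPairing G μ y‖ := by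
  obtain ⟨v, rfl⟩ := exists_toSpace_eq y
  rw [norm_toSpace]
  refine ENNReal.toReal_le_of_le_ofReal (by positivity) ?_
  exact orliczENorm_conj_le_of_representation v.2.1 fun u =>
    ⟨integrable_mul_of_mem u.2 v.2, orliczPairing_toSpace v u⟩

/-- No reflexivity of `L^{G*}` is needed: separation takes place in the dual of `L^G`. The
separating bidual element is evaluation at some `u` whose integrals over sets of finite measure
vanish, so `u = 0`. -/
theorem IsReflexiveSpace.hasFiniteModular_conj (h : IsReflexiveSpace (OrliczSpace G μ)) :
    HasFiniteModular G.conj μ := by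
  intro v hv hfin
  by_contra hinf
  have hinf : modular G.conj μ v = ∞ := not_lt_top_iff.1 hinf
  set V : OrliczFun G.conj μ := ⟨v, hv, hfin⟩ with hV
  obtain ⟨Ψ, hΨ, hne⟩ := exists_functional_vanishing_on
    ((orliczHeart G.conj μ).map (orliczPairing G μ).toLinearMap)
    (x := orliczPairing G μ (toSpace V)) (ε := 1 / 4) (by norm_num) (by
      rintro _ ⟨y, hy, rfl⟩
      have h1 := half_le_norm_sub (u := V) hinf hy
      have h2 := norm_le_two_mul_norm_orliczPairing (toSpace V - y)
      rw [map_sub] at h2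
      change 1 / 4 ≤ ‖orliczPairing G μ (toSpace V) - orliczPairing G μ y‖
      linarith)
  obtain ⟨y, rfl⟩ := h Ψ
  obtain ⟨u, rfl⟩ := exists_toSpace_eq y
  have hu : toSpace u = toSpace (0 : OrliczFun G μ) :=
    ae_eq_of_orliczPairing_indicator fun s hs hμs => by
      rw [map_zero, map_zero]
      have := hΨ _ (Submodule.mem_map_of_mem (f := (orliczPairing G μ).toLinearMap)
        (toSpace_mem_orliczHeart (u := ⟨_, indicator_one_mem_orliczFun hs hμs⟩)
          (modular_smul_indicator_lt_top hs hμs)))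
      rwa [NormedSpace.dual_def] at this
  rw [hu, map_zero, map_zero] at hne
  exact hne rfl

theorem isReflexiveSpace_orliczSpace_iff :
    IsReflexiveSpace (OrliczSpace G μ) ↔ HasFiniteModular G μ ∧ HasFiniteModular G.conj μ :=
  ⟨fun h => ⟨h.hasFiniteModular, h.hasFiniteModular_conj⟩,
    fun h => isReflexiveSpace_of_hasFiniteModular h.1 h.2⟩

end SigmaFinite

end Orlicz

/-! ### Step functions and the failure of finite modular -/

section Step

variable {α : Type*} {A : ℕ → Set α} {a : ℕ → ℝ}

/-- The function with value `a n` on the set `A n`, the `A n` being disjoint. -/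
noncomputable def stepFunction (A : ℕ → Set α) (a : ℕ → ℝ) (x : α) : ℝ :=
  (∑' n, (A n).indicator (fun _ => ENNReal.ofReal (a n)) x).toReal

theorem stepFunction_of_mem (hd : Pairwise (Function.onFun Disjoint A)) (ha : ∀ n, 0 ≤ a n)
    {n : ℕ} {x : α} (hx : x ∈ A n) : stepFunction A a x = a n := by
  rw [stepFunction, tsum_eq_single n fun k hk => indicator_of_notMem
    (fun hxk => disjoint_left.1 (hd hk) hxk hx) _, indicator_of_mem hx,
    ENNReal.toReal_ofReal (ha n)]

theorem stepFunction_of_notMem {x : α} (hx : ∀ n, x ∉ A n) : stepFunction A a x = 0 := by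
  have h : ∀ n, (A n).indicator (fun _ => ENNReal.ofReal (a n)) x = 0 := fun n =>
    indicator_of_notMem (hx n) _
  simp [stepFunction, h]

theorem two_smul_stepFunction (hd : Pairwise (Function.onFun Disjoint A)) (ha : ∀ n, 0 ≤ a n) :
    (2 : ℝ) • stepFunction A a = stepFunction A fun n => 2 * a n := by
  funext x
  rw [Pi.smul_apply, smul_eq_mul]
  by_cases hx : ∃ n, x ∈ A n
  · obtain ⟨n, hx⟩ := hx
    rw [stepFunction_of_mem hd ha hx,
      stepFunction_of_mem hd (fun n => mul_nonneg zero_le_two (ha n)) hx]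
  · rw [not_exists] at hx
    rw [stepFunction_of_notMem hx, stepFunction_of_notMem hx, mul_zero]

theorem measurable_stepFunction [MeasurableSpace α] (hA : ∀ n, MeasurableSet (A n)) :
    Measurable (stepFunction A a) :=
  (Measurable.tsum fun n => measurable_const.indicator (hA n)).ennreal_toReal

theorem modular_stepFunction [MeasurableSpace α] {G : NFunction} {μ : Measure α}
    (hA : ∀ n, MeasurableSet (A n))
    (hd : Pairwise (Function.onFun Disjoint A)) (ha : ∀ n, 0 ≤ a n) :
    modular G μ (stepFunction A a) = ∑' n, ENNReal.ofReal (G.eval (a n)) * μ (A n) := by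
  have e : ∀ x, ENNReal.ofReal (G.eval |stepFunction A a x|) =
      ∑' n, (A n).indicator (fun _ => ENNReal.ofReal (G.eval (a n))) x := by
    intro x
    by_cases hx : ∃ n, x ∈ A n
    · obtain ⟨n, hx⟩ := hx
      rw [stepFunction_of_mem hd ha hx, abs_of_nonneg (ha n), tsum_eq_single n fun k hk =>
        indicator_of_notMem (fun hxk => disjoint_left.1 (hd hk) hxk hx) _, indicator_of_mem hx]
    · rw [not_exists] at hx
      have h : ∀ n, (A n).indicator (fun _ => ENNReal.ofReal (G.eval (a n))) x = 0 := fun n =>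
        indicator_of_notMem (hx n) _
      simp [stepFunction_of_notMem hx, h, G.eval_zero]
  simp only [modular, e]
  rw [lintegral_tsum fun n => (measurable_const.indicator (hA n)).aemeasurable]
  exact tsum_congr fun n => lintegral_indicator_const (hA n) _

end Step

section Orlicz

variable {α : Type*} [MeasurableSpace α] {G : NFunction} {μ : Measure α}

/-- With these measures the step function has modular `∑ c 2^(-n)`, while each term for its double
is at least `c`, since `G(2 t n)` gains the factor `2^n`. -/
theorem not_hasFiniteModular_of_disjoint {A : ℕ → Set α} {t : ℕ → ℝ} {c : ℝ} (hc : 0 < c)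
    (hA : ∀ n, MeasurableSet (A n)) (hd : Pairwise (Function.onFun Disjoint A))
    (ht : ∀ n, 0 < t n) (hG : ∀ n, 2 ^ n * G.eval (t n) < G.eval (2 * t n))
    (hμ : ∀ n, μ (A n) = ENNReal.ofReal (c * (1 / 2) ^ n / G.eval (t n))) :
    ¬ HasFiniteModular G μ := by
  intro h
  have hpos : ∀ n, 0 < G.eval (t n) := fun n => G.eval_pos (ht n)
  have h1 : modular G μ (stepFunction A t) < ∞ := by
    rw [modular_stepFunction hA hd fun n => (ht n).le]
    have e : ∀ n, ENNReal.ofReal (G.eval (t n)) * μ (A n) = ENNReal.ofReal (c * (1 / 2) ^ n) := by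
      intro n
      rw [hμ, ← ENNReal.ofReal_mul (hpos n).le, mul_div_cancel₀ _ (hpos n).ne']
    simp only [e]
    exact (summable_geometric_two.mul_left c).tsum_ofReal_lt_top
  have h2 : stepFunction A (fun n => 2 * t n) ∈ OrliczFun G μ := by
    rw [← two_smul_stepFunction hd fun n => (ht n).le]
    exact (OrliczFun G μ).smul_mem 2
      (OrliczFun.mem_of_modular (measurable_stepFunction hA) h1)
  refine (h _ h2.1 h2.2).ne (top_le_iff.1 ?_)
  rw [modular_stepFunction hA hd fun n => mul_nonneg zero_le_two (ht n).le,
    ← ENNReal.tsum_const_eq_top_of_ne_zero (α := ℕ) (ENNReal.ofReal_pos.2 hc).ne']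
  refine ENNReal.tsum_le_tsum fun n => ?_
  rw [hμ, ← ENNReal.ofReal_mul (G.eval_nonneg (mul_nonneg zero_le_two (ht n).le))]
  refine ENNReal.ofReal_le_ofReal ?_
  rw [← mul_div_assoc, le_div_iff₀ (hpos n)]
  have h3 := mul_le_mul_of_nonneg_left (hG n).le (by positivity : 0 ≤ c * (1 / 2) ^ n)
  have h4 : c * (1 / 2) ^ n * (2 ^ n * G.eval (t n)) = c * G.eval (t n) := by
    rw [one_div, inv_pow]
    field_simp
  linarith

end Orlicz

/-! ### Shells of prescribed measure and the growth conditions -/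

section Shells

variable {E : Type*} [NormedAddCommGroup E] [NormedSpace ℝ E] [FiniteDimensional ℝ E]
  [Nontrivial E] [MeasurableSpace E] [BorelSpace E] (ν : Measure E) [ν.IsAddHaarMeasure]
  (Ω : Set E)

/-- Increments in `r` are at most those of the full ball volume, a constant times a power of `r`. -/
theorem continuousOn_measureReal_restrict_ball :
    ContinuousOn (fun r => (ν.restrict Ω).real (Metric.ball 0 r)) (Ici 0) := by
  set V : ℝ → ℝ := fun r => r ^ Module.finrank ℝ E * ν.real (Metric.ball 0 1) with hV
  have hVball : ∀ r, 0 ≤ r → ν.real (Metric.ball 0 r) = V r := fun r hr => by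
    rw [measureReal_def, Measure.addHaar_ball ν 0 hr, ENNReal.toReal_mul,
      ENNReal.toReal_ofReal (by positivity)]
    rfl
  have hle : ∀ r s, 0 ≤ r → r ≤ s → (ν.restrict Ω).real (Metric.ball 0 s) -
      (ν.restrict Ω).real (Metric.ball 0 r) ≤ V s - V r := by
    intro r s hr hrs
    have hsub : Metric.ball (0 : E) r ⊆ Metric.ball 0 s := Metric.ball_subset_ball hrs
    rw [← hVball r hr, ← hVball s (hr.trans hrs),
      ← measureReal_sdiff hsub measurableSet_ball
        ((Measure.restrict_apply_le _ _).trans_lt measure_ball_lt_top).ne,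
      ← measureReal_sdiff hsub measurableSet_ball measure_ball_lt_top.ne]
    exact ENNReal.toReal_mono ((measure_mono sdiff_subset).trans_lt measure_ball_lt_top).ne
      (Measure.restrict_apply_le _ _)
  have hmono : ∀ r s, r ≤ s → (ν.restrict Ω).real (Metric.ball 0 r) ≤
      (ν.restrict Ω).real (Metric.ball 0 s) := fun r s hrs =>
    measureReal_mono (Metric.ball_subset_ball hrs)
      ((Measure.restrict_apply_le _ _).trans_lt measure_ball_lt_top).ne
  have hdist : ∀ r s, 0 ≤ r → 0 ≤ s → dist ((ν.restrict Ω).real (Metric.ball 0 s))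
      ((ν.restrict Ω).real (Metric.ball 0 r)) ≤ dist (V s) (V r) := by
    intro r s hr hs
    rcases le_total r s with h | h
    · rw [Real.dist_eq, Real.dist_eq, abs_of_nonneg (sub_nonneg.2 (hmono r s h))]
      exact (hle r s hr h).trans (le_abs_self _)
    · rw [dist_comm, dist_comm (V s), Real.dist_eq, Real.dist_eq,
        abs_of_nonneg (sub_nonneg.2 (hmono s r h))]
      exact (hle s r hs h).trans (le_abs_self _)
  have hVc : Continuous V := by fun_prop
  intro r hr
  rw [ContinuousWithinAt, tendsto_iff_dist_tendsto_zero]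
  have h0 : Tendsto (fun s => dist (V s) (V r)) (𝓝[Ici 0] r) (𝓝 0) :=
    tendsto_iff_dist_tendsto_zero.1 (hVc.continuousWithinAt)
  refine squeeze_zero' (Eventually.of_forall fun _ => dist_nonneg) ?_ h0
  filter_upwards [self_mem_nhdsWithin] with s hs
  exact hdist r s hr hs

theorem exists_ball_measureReal_eq {s : ℝ} (hs : 0 ≤ s) (h : ENNReal.ofReal s < ν Ω) :
    ∃ r, (ν.restrict Ω).real (Metric.ball 0 r) = s := by
  have hlim : Tendsto (fun n : ℕ => ν.restrict Ω (Metric.ball 0 n)) atTop (𝓝 (ν Ω)) := by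
    have h1 := tendsto_measure_iUnion_atTop (μ := ν.restrict Ω)
      (s := fun n : ℕ => Metric.ball (0 : E) n)
      fun m n hmn => Metric.ball_subset_ball (by exact_mod_cast hmn)
    rwa [Metric.iUnion_ball_nat, Measure.restrict_apply_univ] at h1
  obtain ⟨n, hn⟩ := (hlim.eventually_const_lt h).exists
  have hn' : s ≤ (ν.restrict Ω).real (Metric.ball 0 n) :=
    (ENNReal.ofReal_le_iff_le_toReal
      ((Measure.restrict_apply_le _ _).trans_lt measure_ball_lt_top).ne).1 hn.le
  obtain ⟨r, -, hr⟩ := intermediate_value_Icc (Nat.cast_nonneg n)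
    ((continuousOn_measureReal_restrict_ball ν Ω).mono Icc_subset_Ici_self)
    (show s ∈ Icc _ _ from ⟨by simpa using hs, hn'⟩)
  exact ⟨r, hr⟩

/-- Disjoint sets of prescribed measures. -/
theorem exists_disjoint_measure_eq {m : ℕ → ℝ} (hm : ∀ n, 0 < m n)
    (h : ∀ n, ENNReal.ofReal (∑ i ∈ Finset.range n, m i) < ν Ω) :
    ∃ A : ℕ → Set E, (∀ n, MeasurableSet (A n)) ∧ Pairwise (Function.onFun Disjoint A) ∧
      ∀ n, ν.restrict Ω (A n) = ENNReal.ofReal (m n) := by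
  -- The radii are chosen so that the balls carry the partial sums of `m`; the shells between
  -- consecutive balls then carry `m n`.
  choose r hr using fun n => exists_ball_measureReal_eq ν Ω
    (Finset.sum_nonneg fun i _ => (hm i).le : 0 ≤ ∑ i ∈ Finset.range n, m i) (h n)
  have hfin : ∀ r, ν.restrict Ω (Metric.ball 0 r) ≠ ∞ := fun r =>
    ((Measure.restrict_apply_le _ _).trans_lt measure_ball_lt_top).ne
  have hmono : Monotone r := monotone_nat_of_le_succ fun n => by
    by_contra! hlt
    have h1 := measureReal_mono (Metric.ball_subset_ball (x := (0 : E)) hlt.le) (hfin _)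
    rw [hr, hr, Finset.sum_range_succ] at h1
    linarith [hm n]
  have hsub : ∀ n, Metric.ball (0 : E) (r n) ⊆ Metric.ball 0 (r (n + 1)) := fun n =>
    Metric.ball_subset_ball (hmono n.le_succ)
  have e : ∀ n, norm ⁻¹' Ico (r n) (r (n + 1)) =
      Metric.ball (0 : E) (r (n + 1)) \ Metric.ball 0 (r n) := fun n => by
    ext x
    simp [and_comm]
  refine ⟨fun n => norm ⁻¹' Ico (r n) (r (n + 1)), fun n => measurable_norm measurableSet_Ico,
    fun i j hij => (hmono.pairwise_disjoint_on_Ico_succ hij).preimage norm, fun n => ?_⟩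
  simp only [e]
  rw [← ENNReal.ofReal_toReal (ne_top_of_le_ne_top (hfin _) (measure_mono sdiff_subset)),
    ← measureReal_def, measureReal_sdiff (hsub n) measurableSet_ball (hfin _), hr, hr,
    Finset.sum_range_succ, add_sub_cancel_left]

variable {ν Ω} {G : NFunction}

theorem HasFiniteModular.delta2 (hpos : 0 < ν Ω) (hfin : ν Ω < ∞)
    (h : HasFiniteModular G (ν.restrict Ω)) : G.Delta2 := by
  by_contra hΔ
  simp only [NFunction.Delta2, not_exists, not_and, not_forall, not_le] at hΔ
  obtain ⟨T, hT⟩ := eventually_atTop.1 (G.eval_tendsto.eventually_ge_atTop 1)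
  -- The failure of `Δ₂` with `k = 2^n`, beyond a threshold ensuring `t n > 0` and `G(t n) ≥ 1`.
  choose t htT hG using fun n : ℕ =>
    hΔ (2 ^ n) (by positivity) (max T 1) (zero_le_one.trans (le_max_right _ _))
  have ht1 : ∀ n, 1 ≤ G.eval (t n) := fun n => hT _ ((le_max_left _ _).trans (htT n))
  have ht : ∀ n, 0 < t n := fun n => one_pos.trans_le ((le_max_right _ _).trans (htT n))
  -- As `G(t n) ≥ 1`, the shells use at most `2c`, half of the measure of `Ω`.
  set c : ℝ := (ν Ω).toReal / 4 with hc
  have hV : 0 < (ν Ω).toReal := ENNReal.toReal_pos hpos.ne' hfin.ne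
  have hc0 : 0 < c := by positivity
  obtain ⟨A, hA, hd, hμ⟩ := exists_disjoint_measure_eq ν Ω
    (m := fun n => c * (1 / 2) ^ n / G.eval (t n))
    (fun n => div_pos (by positivity) (G.eval_pos (ht n))) fun n => by
      rw [ENNReal.ofReal_lt_iff_lt_toReal
        (Finset.sum_nonneg fun i _ => div_nonneg (by positivity) (G.eval_nonneg (ht i).le))
        hfin.ne]
      calc ∑ i ∈ Finset.range n, c * (1 / 2) ^ i / G.eval (t i)
          ≤ ∑ i ∈ Finset.range n, c * (1 / 2) ^ i :=
            Finset.sum_le_sum fun i _ => div_le_self (by positivity) (ht1 i)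
        _ ≤ c * 2 := by
            rw [← Finset.mul_sum]
            exact mul_le_mul_of_nonneg_left (sum_geometric_two_le n) hc0.le
        _ < (ν Ω).toReal := by rw [hc]; linarith
  exact not_hasFiniteModular_of_disjoint hc0 hA hd ht hG hμ h

/-- With infinite measure there is room for shells of any size, so the `t n` may be arbitrarily
small and no threshold is needed. -/
theorem HasFiniteModular.delta2Zero (hinf : ν Ω = ∞) (h : HasFiniteModular G (ν.restrict Ω)) :
    G.Delta2Zero := by
  by_contra hΔ
  simp only [NFunction.Delta2Zero, not_exists, not_and, not_forall, not_le] at hΔ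
  choose t ht0 hG using fun n : ℕ => hΔ (2 ^ n) (by positivity)
  have ht : ∀ n, 0 < t n := fun n => (ht0 n).lt_of_ne fun h0 => by
    have := hG n
    simp [← h0, G.eval_zero] at this
  obtain ⟨A, hA, hd, hμ⟩ := exists_disjoint_measure_eq ν Ω
    (m := fun n => 1 * (1 / 2) ^ n / G.eval (t n))
    (fun n => div_pos (by positivity) (G.eval_pos (ht n))) fun n => by
      rw [hinf]; exact ENNReal.ofReal_lt_top
  exact not_hasFiniteModular_of_disjoint one_pos hA hd ht hG hμ h

end Shells

theorem mainTheorem7 {N : ℕ} (hN : 1 ≤ N) (Ω : Set (EuclideanSpace ℝ (Fin N)))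
    (hΩ : IsOpen Ω) (hΩne : Ω.Nonempty) (G : NFunction) :
    (volume Ω < ∞ →
      (IsReflexiveSpace (OrliczSpace G (volume.restrict Ω)) ↔ G.Delta2 ∧ G.conj.Delta2)) ∧
    (volume Ω = ∞ →
      (IsReflexiveSpace (OrliczSpace G (volume.restrict Ω)) ↔
        G.Delta2Zero ∧ G.conj.Delta2Zero)) := by
  -- Supplies the `Nontrivial` instance required by the shell lemmas.
  have : Nonempty (Fin N) := ⟨⟨0, hN⟩⟩
  refine ⟨fun hfin => ?_, fun hinf => ?_⟩
  · have : IsFiniteMeasure (volume.restrict Ω) := isFiniteMeasure_restrict.2 hfin.ne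
    have hpos : 0 < volume Ω := hΩ.measure_pos volume hΩne
    rw [isReflexiveSpace_orliczSpace_iff]
    exact and_congr ⟨fun h => h.delta2 hpos hfin, fun h => h.hasFiniteModular⟩
      ⟨fun h => h.delta2 hpos hfin, fun h => h.hasFiniteModular⟩
  · rw [isReflexiveSpace_orliczSpace_iff]
    exact and_congr ⟨fun h => h.delta2Zero hinf, fun h => h.hasFiniteModular⟩
      ⟨fun h => h.delta2Zero hinf, fun h => h.hasFiniteModular⟩
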